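/- All rings are associative unital $\mathbb C$-algebras. For a multiplicatively closed subset $S$ of the center of $R$, the central localization is $R[S^{-1}]=(R\times S)/\!\sim$; localizations of $R$ at $S_1,\dots,S_k$ form a finite central cover if $\sum_i I_i=R$ whenever $I_i$ are ideals with $I_i\cap S_i\neq\emptyset$. A finite gluing system $\mathcal R=(\{R_\alpha\}_{\alpha\in A},\{R_{\alpha\beta}\})$ consists of algebras $R_\alpha$, central localizations $R_\alpha\to R_{\alpha\beta}=R_\alpha[S_{\alpha\beta}^{-1}]$ forming a finite central cover for each $\alpha$, with $R_{\alpha\alpha}=R_\alpha$, and isomorphisms $\varphi_{\alpha\beta}:R_{\alpha\beta}\to R_{\beta\alpha}$ with $\varphi_{\alpha\beta}=\varphi_{\beta\alpha}^{-1}$, $\varphi_{\alpha\alpha}=\mathrm{Id}$, that descend to the triple localizations and satisfy the cocycle condition there. A morphism of gluing systems is given by algebra homomorphisms on charts that map the multiplicative sets into the multiplicative sets and whose descents to overlaps commute with the gluing isomorphisms. A ring-set-homomorphism is a map with all properties of an algebra homomorphism except that $1$ need not map to $1$; $\mathrm{Mor}^{\text{ring-set}}(R,M_n(\mathbb C))$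 is the set of these. Let $Y$ be presented by a finite gluing system $\mathcal R$ with all $R_\alpha$ finitely presentable and all $S_{\alpha\beta}$ finitely generated, and fix a linear order on $A$. Let $\mathrm{Mor}(\mathrm{Space}\,M_n(\mathbb C),Y)\subset\prod_{\alpha}\mathrm{Mor}^{\text{ring-set}}(R_\alpha,M_n(\mathbb C))$ be the set of tuples $(\varphi_\alpha)$ that represent a morphism, i.e. for which there are a subalgebra $T\subset M_n(\mathbb C)$, a finite central cover $\{T\to T_\alpha\}_{\alpha\in A}$ with its associated gluing system, and a morphism of gluing systems $\mathcal R\to(\{T_\alpha\},\{T_{\alpha\beta}\})$ over the identity of $A$ with surjective charts $R_\alpha\to T_\alpha$, such that $\varphi_\alpha$ is the composite $R_\alpha\to T_\alpha\cong e_\alpha T\subset M_n(\mathbb C)$, with $e_\alpha=\varphi_\alpha(1)$ and $T_\alpha\cong e_\alpha T$ the canonical realization of the localization $T_\alpha$ as a ring-subset of $T$. Choose data of presentation: finite presentations $R_\alpha=\langle g^{(\alpha)}_0=1,g^{(\alpha)}_1,\dots,g^{(\alpha)}_{l^{(\alpha)}}\rangle/(r^{(\alpha)}_1,\dots,r^{(\alpha)}_{m^{(\alpha)}})$,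 liftings $\tilde s$ of the elements $s\in S_{\alpha\beta}$ to the free algebras, and representatives $\varphi_{\alpha\beta}(g^{(\alpha)}_i)=g^{(\alpha\beta)}_i/s^{(\alpha\beta)}_i$, $\varphi_{\alpha\beta}(1/s)=g^{(\alpha\beta)}_{\tilde s}/s^{(\alpha\beta)}_{\tilde s}$ in $R_{\beta\alpha}$. Let $\mathbf A=\prod_\alpha M_n(\mathbb C)^{1+l^{(\alpha)}}$, with points $(M_{\alpha,i})$. A noncommutative polynomial $f$ is evaluated at $M_\alpha$ by $g_i\mapsto M_{\alpha,i}$, the unit being sent to $M_{\alpha,0}$; the set of all values at $M_\alpha$ is denoted $\mathrm{Im}_\alpha$. Let $\mathrm{Rep}(\mathcal R)\subset\mathbf A$ be the set of points that satisfy the relations of all charts (including $g_0g_i=g_ig_0=g_i$) and, for all $\alpha,\beta$: (1) $M_{\alpha,0}M_{\beta,i}=M_{\beta,i}M_{\alpha,0}$; (2) $M_{\alpha,0}\mathrm{Im}_\beta=M_{\beta,0}\mathrm{Im}_\alpha$; (3) $M_{\alpha,0}M_{\beta,0}\in\mathrm{Im}_\alpha$; (4) $\mathbf 1=\sum_{\emptyset\ne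 K\subset A}(-1)^{|K|+1}\prod_{\alpha\in K}M_{\alpha,0}$ (products in the order of $A$); (5) $M_{\beta,0}\,m=0$ for all $s\in S_{\alpha\beta}$ and $m\in\mathrm{Im}_\alpha$ with $\tilde s(M_\alpha)m=0$; (6) $(M_{\beta,0}M_{\alpha,i})(M_{\alpha,0}s^{(\alpha\beta)}_i(M_\beta))=M_{\alpha,0}g^{(\alpha\beta)}_i(M_\beta)$ and $(M_{\beta,0}M_{\alpha,0})(M_{\alpha,0}s^{(\alpha\beta)}_{\tilde s}(M_\beta))=(M_{\alpha,0}g^{(\alpha\beta)}_{\tilde s}(M_\beta))(M_{\beta,0}\tilde s(M_\alpha))$ for all $i$ and all $s\in S_{\alpha\beta}$. Then such data exist, and for every choice of them the map $(\varphi_\alpha)\mapsto(\varphi_\alpha(g^{(\alpha)}_i))$ is a bijection from $\prod_\alpha\mathrm{Mor}^{\text{ring-set}}(R_\alpha,M_n(\mathbb C))$ onto the subvariety $\prod_\alpha\mathrm{Rep}^{\text{ring-set}}(R_\alpha,M_n(\mathbb C))_{\mathbb C}$ of $\mathbf A$ given by the relations of the charts; it carries $\mathrm{Mor}(\mathrm{Space}\,M_n(\mathbb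 C),Y)$ onto $\mathrm{Rep}(\mathcal R)$, and $\mathrm{Rep}(\mathcal R)$ is a (Zariski) constructible set. This is independent of the data of presentation: for two choices there are polynomial maps in both directions between the affine spaces that intertwine the two maps $(\varphi_\alpha)\mapsto(\varphi_\alpha(g_i^{(\alpha)}))$, and hence restrict to mutually inverse bijections between the two sets $\mathrm{Rep}(\mathcal R)$. -/

import Mathlib

universe u v w

/-- `f : R → R'` is the central localization of the (noncommutative) `ℂ`-algebra `R` at the
multiplicatively closed subset `S` of its center: `R' = (R × S)/∼` with
`(r₁, s₁) ∼ (r₂, s₂)` iff `s (r₁ s₂ - r₂ s₁) = 0` for some `s ∈ S`. -/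
structure IsCentralLocalization {R : Type u} {R' : Type w} [Ring R] [Algebra ℂ R]
    [Ring R'] [Algebra ℂ R'] (S : Submonoid R) (f : R →ₐ[ℂ] R') : Prop where
  central : ∀ s ∈ S, s ∈ Set.center R
  isUnit : ∀ s ∈ S, IsUnit (f s)
  surj : ∀ y : R', ∃ r : R, ∃ s ∈ S, f s * y = f r
  exists_of_eq : ∀ r r' : R, f r = f r' → ∃ s ∈ S, s * r = s * r'

/-- The localizations of `R` at the `S α` form a cover: whenever `I α` belongs to the Gabriel
filter `{I | I ∩ S α ≠ ∅}` for every `α`, the ideals `I α` together sum up to `R`. -/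
def IsCentralCover {A : Type v} {R : Type u} [Ring R] (S : A → Submonoid R) : Prop :=
  ∀ I : A → Ideal R, (∀ α, ∃ s ∈ S α, s ∈ I α) → ⨆ α, I α = ⊤

/-- A gluing system of `ℂ`-algebras from central localizations: charts `R α`, overlaps `R₂ α β`
(a central localization of `R α`), gluing isomorphisms `R₂ α β ≃ R₂ β α`, and the triple overlaps
`R₃ α β γ`, the push-out of `R α → R₂ α γ` along `R α → R₂ α β`, on which the cocycle condition
is stated. The maps `swap` are the canonical isomorphisms of push-outs, and the triple overlaps
with all maps on them are determined by the rest up to unique isomorphism. -/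
structure GluingSystem (A : Type v) where
  R : A → Type u
  [ring : ∀ α, Ring (R α)]
  [algebra : ∀ α, Algebra ℂ (R α)]
  R₂ : A → A → Type u
  [ring₂ : ∀ α β, Ring (R₂ α β)]
  [algebra₂ : ∀ α β, Algebra ℂ (R₂ α β)]
  S : ∀ α : A, A → Submonoid (R α)
  loc : ∀ α β, R α →ₐ[ℂ] R₂ α β
  isLoc : ∀ α β, IsCentralLocalization (S α β) (loc α β)
  cover : ∀ α, IsCentralCover (S α)
  loc_self : ∀ α, Function.Bijective (loc α α)
  glue : ∀ α β, R₂ α β ≃ₐ[ℂ] R₂ β α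
  glue_symm : ∀ α β, glue β α = (glue α β).symm
  glue_self : ∀ α, glue α α = AlgEquiv.refl
  R₃ : A → A → A → Type u
  [ring₃ : ∀ α β γ, Ring (R₃ α β γ)]
  [algebra₃ : ∀ α β γ, Algebra ℂ (R₃ α β γ)]
  loc₃ : ∀ α β γ, R₂ α β →ₐ[ℂ] R₃ α β γ
  isLoc₃ : ∀ α β γ, IsCentralLocalization ((S α γ).map (loc α β)) (loc₃ α β γ)
  swap : ∀ α β γ, R₃ α β γ ≃ₐ[ℂ] R₃ α γ β
  swap_loc : ∀ α β γ (x : R α),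
    swap α β γ (loc₃ α β γ (loc α β x)) = loc₃ α γ β (loc α γ x)
  glue₃ : ∀ α β γ, R₃ α β γ ≃ₐ[ℂ] R₃ β α γ
  glue₃_loc : ∀ α β γ (y : R₂ α β),
    glue₃ α β γ (loc₃ α β γ y) = loc₃ β α γ (glue α β y)
  cocycle : ∀ α β γ (z : R₃ α β γ),
    swap γ β α (glue₃ β γ α (swap β α γ (glue₃ α β γ z))) = glue₃ α γ β (swap α β γ z)

namespace GluingSystem

attribute [instance] ring algebra ring₂ algebra₂ ring₃ algebra₃

/-- A morphism (gluing system of algebra homomorphisms) from `ℛ` to `𝒮` over the map `τ` of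
index sets: chart maps that are admissible for the localizations, hence descend to (unique) maps
`map₂` on overlaps, and these are compatible with the gluing isomorphisms. -/
structure Hom {A : Type v} {B : Type v} (τ : B → A) (ℛ : GluingSystem.{u} A)
    (𝒮 : GluingSystem.{w} B) where
  map : ∀ β, ℛ.R (τ β) →ₐ[ℂ] 𝒮.R β
  admissible : ∀ β₁ β₂, ∀ s ∈ ℛ.S (τ β₁) (τ β₂), map β₁ s ∈ 𝒮.S β₁ β₂
  map₂ : ∀ β₁ β₂, ℛ.R₂ (τ β₁) (τ β₂) →ₐ[ℂ] 𝒮.R₂ β₁ β₂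
  map₂_loc : ∀ β₁ β₂ (x : ℛ.R (τ β₁)),
    map₂ β₁ β₂ (ℛ.loc (τ β₁) (τ β₂) x) = 𝒮.loc β₁ β₂ (map β₁ x)
  map₂_glue : ∀ β₁ β₂ (y : ℛ.R₂ (τ β₁) (τ β₂)),
    map₂ β₂ β₁ (ℛ.glue (τ β₁) (τ β₂) y) = 𝒮.glue β₁ β₂ (map₂ β₁ β₂ y)

/-- `𝒮` is the gluing system associated to a finite central cover `p α : T → 𝒮.R α` of the single
algebra `T`: the chart `𝒮.R α` is the central localization of `T` at `N α`, the overlap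
`𝒮.R₂ α β` is the push-out of `p β` along `p α`, and the gluing isomorphisms are the
canonical ones. -/
structure CoverOf {A : Type v} (𝒮 : GluingSystem.{w} A) (T : Type w) [Ring T]
    [Algebra ℂ T] where
  N : A → Submonoid T
  p : ∀ α, T →ₐ[ℂ] 𝒮.R α
  isLoc : ∀ α, IsCentralLocalization (N α) (p α)
  cover : IsCentralCover N
  overlap : ∀ α β, 𝒮.S α β = (N β).map (p α)
  glue_loc : ∀ α β (x : T), 𝒮.glue α β (𝒮.loc α β (p α x)) = 𝒮.loc β α (p β x)

end GluingSystem

/-- The matrix algebra `M_n(ℂ)`. -/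
abbrev Mat (n : ℕ) : Type := Matrix (Fin n) (Fin n) ℂ

/-- `Mor^{ring-set}(R, M_n(ℂ))`: the maps `R → M_n(ℂ)` satisfying all requirements of a
`ℂ`-algebra homomorphism except that `1` need not go to `1`. -/
abbrev RingSetHom (R : Type u) [Ring R] [Algebra ℂ R] (n : ℕ) : Type u := R →ₙₐ[ℂ] Mat n

/-- The tuple `φ = (φ_α : R_α → M_n(ℂ))_α` of ring-set-homomorphisms represents a morphism from
the noncommutative point `Space M_n(ℂ)` to the space presented by `ℛ`, that is, there is a diagram
`ℛ ⟶ 𝒮 ≺ {T} ⟶ {M_n(ℂ)}` with `T` a subalgebra of `M_n(ℂ)` (a surrogate of the point), `𝒮` the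
gluing system of a finite central cover of `T`, and `ℛ ⟶ 𝒮` a morphism of gluing systems whose
charts are onto, such that `φ_α` is the composite of the chart map `R_α → 𝒮_α` with the canonical
inclusion `sec α` of the localization `𝒮_α` of `T` into `T` as the ring-subset `e_α T`, where
`e_α = sec α 1`. -/
def RepresentsMorphism {A : Type v} (ℛ : GluingSystem.{u} A) (n : ℕ)
    (φ : ∀ α, RingSetHom (ℛ.R α) n) : Prop :=
  ∃ (T : Subalgebra ℂ (Mat n)) (𝒮 : GluingSystem.{0} A) (c : 𝒮.CoverOf T)
    (Φ : GluingSystem.Hom id ℛ 𝒮) (sec : ∀ α, 𝒮.R α →ₙₐ[ℂ] T),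
    (∀ α y, c.p α (sec α y) = y) ∧
    (∀ α x, sec α (c.p α x) = sec α 1 * x) ∧
    (∀ α, Function.Surjective (Φ.map α)) ∧
    (∀ α r, φ α r = (sec α (Φ.map α r) : Mat n))

/-- `Mor(Space M_n(ℂ), Y)` for `Y` presented by the gluing system `ℛ`, as a subset of
`∏_α Mor^{ring-set}(R_α, M_n(ℂ))`. -/
def MorSpace {A : Type v} (ℛ : GluingSystem.{u} A) (n : ℕ) :
    Set (∀ α, RingSetHom (ℛ.R α) n) :=
  {φ | RepresentsMorphism ℛ n φ}

/-- A finite presentation `R = ⟨g₁, …, g_l⟩ / (r₁, …, r_m)` of a `ℂ`-algebra. The identity of the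
free algebra plays the role of the redundant generator `g₀ = 1`. -/
structure FinPresentation (R : Type u) [Ring R] [Algebra ℂ R] where
  l : ℕ
  m : ℕ
  rel : Fin m → FreeAlgebra ℂ (Fin l)
  π : FreeAlgebra ℂ (Fin l) →ₐ[ℂ] R
  surj : Function.Surjective π
  ker : ∀ f, π f = 0 ↔ f ∈ TwoSidedIdeal.span (Set.range rel)

/-- The generators `g₀ = 1, g₁, …, g_l`. -/
def freeGen (l : ℕ) : Fin (l + 1) → FreeAlgebra ℂ (Fin l) :=
  Fin.cases 1 (FreeAlgebra.ι ℂ)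

/-- The value `f(M₀, M₁, …, M_l)` of a noncommutative polynomial, where the identity `g₀` of the
free algebra is sent to `M₀`. (The factor `M₀` turns the constant term `c` into `c M₀`, and changes
nothing else as soon as `M₀ M_i = M_i`.) -/
def evalAt {l n : ℕ} (M : Fin (l + 1) → Mat n) (f : FreeAlgebra ℂ (Fin l)) : Mat n :=
  M 0 * FreeAlgebra.lift ℂ (fun i : Fin l => M i.succ) f

/-- Data of presentations and representatives for a gluing system: a finite presentation of each
chart, a lifting to the free algebra of each `S α β`, and representatives of the transition data,
`glue (g_i / 1) = tg / ts` and `glue (1 / s) = tgS / tsS`, in the localization `R₂ β α`. -/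
structure PresentationData {A : Type v} (ℛ : GluingSystem.{u} A) where
  pres : ∀ α, FinPresentation (ℛ.R α)
  lift : ∀ α β, ℛ.S α β → FreeAlgebra ℂ (Fin (pres α).l)
  π_lift : ∀ α β (s : ℛ.S α β), (pres α).π (lift α β s) = s
  tg : ∀ α β, Fin ((pres α).l + 1) → FreeAlgebra ℂ (Fin (pres β).l)
  ts : ∀ α β, Fin ((pres α).l + 1) → ℛ.S β α
  t_spec : ∀ α β i,
    ℛ.glue α β (ℛ.loc α β ((pres α).π (freeGen _ i))) * ℛ.loc β α (ts α β i)
      = ℛ.loc β α ((pres β).π (tg α β i))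
  tgS : ∀ α β, ℛ.S α β → FreeAlgebra ℂ (Fin (pres β).l)
  tsS : ∀ α β, ℛ.S α β → ℛ.S β α
  tS_spec : ∀ α β (s : ℛ.S α β),
    ℛ.loc β α ((pres β).π (tgS α β s)) * ℛ.glue α β (ℛ.loc α β (s : ℛ.R α))
      = ℛ.loc β α (tsS α β s)

namespace PresentationData

variable {A : Type v} {ℛ : GluingSystem.{u} A} (D : PresentationData ℛ) (n : ℕ)

/-- Index set of the coordinates `m^{(α)}_{i,jk}` of the affine space `∏_α ∏_{i=0}^{l_α} 𝔸^{n²}`. -/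
abbrev Coord : Type v := Σ α : A, Fin ((D.pres α).l + 1) × Fin n × Fin n

/-- The matrices `M_{α,i}` of a point of the affine space. -/
def mat {n : ℕ} (x : D.Coord n → ℂ) (α : A) (i : Fin ((D.pres α).l + 1)) : Mat n :=
  Matrix.of fun j k => x ⟨α, i, j, k⟩

/-- The point with `M_{α,i} = φ_α(g_i)` given by a tuple of ring-set-homomorphisms. -/
def coords (φ : ∀ α, RingSetHom (ℛ.R α) n) : D.Coord n → ℂ :=
  fun c => φ c.1 ((D.pres c.1).π (freeGen _ c.2.1)) c.2.2.1 c.2.2.2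

/-- `∏_α Rep^{ring-set}(R_α, M_n(ℂ))`, the points satisfying the relations of all charts,
including `g₀ g_i = g_i g₀ = g_i`. -/
def rep : Set (D.Coord n → ℂ) :=
  {x | ∀ α,
    (∀ i, D.mat x α 0 * D.mat x α i = D.mat x α i ∧ D.mat x α i * D.mat x α 0 = D.mat x α i) ∧
    ∀ j, evalAt (D.mat x α) ((D.pres α).rel j) = 0}

/-- The fiber at the point `x` of the image of the tautological homomorphism on chart `α`. -/
def im {n : ℕ} (x : D.Coord n → ℂ) (α : A) : Set (Mat n) :=
  Set.range (evalAt (D.mat x α))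

/-- The locus `Rep^{ring-set}(ℛ, M_n(ℂ))` cut out in the affine space by the gluing constraints. -/
structure IsInLocus [Fintype A] [LinearOrder A] (x : D.Coord n → ℂ) : Prop where
  mem_rep : x ∈ D.rep n
  comm : ∀ α β i, D.mat x α 0 * D.mat x β i = D.mat x β i * D.mat x α 0
  overlap : ∀ α β,
    (fun m => D.mat x α 0 * m) '' D.im x β = (fun m => D.mat x β 0 * m) '' D.im x α
  idem_mem : ∀ α β, D.mat x α 0 * D.mat x β 0 ∈ D.im x α
  incl_excl : (1 : Mat n) =
    ∑ K ∈ (Finset.univ : Finset A).powerset with K.Nonempty,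
      (-1 : ℂ) ^ (K.card + 1) • ((K.sort (· ≤ ·)).map (fun α => D.mat x α 0)).prod
  push_out : ∀ α β (s : ℛ.S α β), ∀ m ∈ D.im x α,
    evalAt (D.mat x α) (D.lift α β s) * m = 0 → D.mat x β 0 * m = 0
  glue_gen : ∀ α β i,
    (D.mat x β 0 * D.mat x α i) *
        (D.mat x α 0 * evalAt (D.mat x β) (D.lift β α (D.ts α β i)))
      = D.mat x α 0 * evalAt (D.mat x β) (D.tg α β i)
  glue_loc : ∀ α β (s : ℛ.S α β),
    (D.mat x β 0 * D.mat x α 0) *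
        (D.mat x α 0 * evalAt (D.mat x β) (D.lift β α (D.tsS α β s)))
      = (D.mat x α 0 * evalAt (D.mat x β) (D.tgS α β s)) *
          (D.mat x β 0 * evalAt (D.mat x α) (D.lift α β s))

/-- The set of points of the locus. -/
def locus [Fintype A] [LinearOrder A] : Set (D.Coord n → ℂ) := {x | D.IsInLocus n x}

end PresentationData

/-- A constructible subset of the affine space `ℂ^σ` (Zariski topology on `ℂ`-points): a finite
union of sets `{p = 0 for all p ∈ P, q ≠ 0}` with `P` a finite set of polynomials. -/
def IsZariskiConstructible {σ : Type v} (Z : Set (σ → ℂ)) : Prop :=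
  ∃ F : Set (Finset (MvPolynomial σ ℂ) × MvPolynomial σ ℂ), F.Finite ∧
    Z = {x | ∃ c ∈ F, (∀ p ∈ c.1, MvPolynomial.eval x p = 0) ∧ MvPolynomial.eval x c.2 ≠ 0}

/-- A map between affine spaces given by polynomials. -/
def IsPolynomialMap {σ τ : Type v} (f : (σ → ℂ) → (τ → ℂ)) : Prop :=
  ∃ P : τ → MvPolynomial σ ℂ, ∀ x j, f x j = MvPolynomial.eval x (P j)

/-!
A presentation identifies a ring-set-homomorphism of a chart with the matrices to which it sends the
generators, because evaluation at matrices satisfying the relations kills the two-sided ideal of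
relations (`FinPresentation.exists_ringSetHom`, `PresentationData.range_coords`); under this
identification, evaluating a noncommutative polynomial is applying the homomorphism to the element
that it represents (`PresentationData.evalAt_coords`). Everything else is about the tuple
`φ = (φ_α)` with units `e_α = φ_α(1)`.

If `φ` represents a morphism through `T`, the section of a localization `T → T_α` realizes it as
`e_α T` with `e_α` a central idempotent of `T`, on which every element of the multiplicatively closed
set of `α` is invertible (`IsCentralLocalization.section_one_mem_center`,
`IsCentralLocalization.exists_inverse`). The constraints of the locus are then read off: the cover
condition says `∏ (1 - e_α) = 0`, and the constraints on transition data are the relations in the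
overlap of `α` and `β`, an equality there being one in `e_α e_β T`.

Conversely, at a point of the locus let `T` consist of the matrices that commute with all `e_α` and
whose blocks `e_α x` lie in the images `B_α` of the `φ_α` (`blockAlgebra`). The constraints give
`B_α ⊆ T`, so that `e_α T = B_α` and the `e_α` are central idempotents of `T`. Such idempotents define
a gluing system covering `T` (`idempotentGluing`), in which the multiplicatively closed sets are taken
as large as possible: all central elements that become invertible on the chart in question. The image
`σ` of an element of `S_αβ` lifts to the element `σ + 1 - e_α` of such a set, because `σ` acts
injectively, hence invertibly, on the finite-dimensional block `e_β B_α`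
(`RingSetHom.injective_iff_exists_inverse`). The maps on overlaps come from the universal property of
central localizations, and they respect the gluing because they do so on generators.

For constructibility, all equations together define a closed set by Hilbert's basis theorem. The
remaining constraints are memberships in images of the spaces `Im_α` under linear maps, once the
push-out condition for `s` is restated as the existence of an inverse of `s`, which needs to be
required for generators only. As `Im_α` is spanned by the values of words of bounded length
(`exists_words`), these are memberships in spans of finitely many polynomial matrices, which are
constructible conditions by Gaussian elimination (`IsZariskiConstructible.setOf_mem_span`).

Two presentations are compared by writing the generators of one as noncommutative polynomials in the
generators of the other.
-/

/-! ### Central localizations -/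

namespace IsCentralLocalization

variable {R : Type u} {R' : Type w} [Ring R] [Algebra ℂ R] [Ring R'] [Algebra ℂ R']
  {S : Submonoid R} {f : R →ₐ[ℂ] R'}

/-- `f s` is central in the localization: every element is a fraction, and denominators cancel. -/
theorem map_comm (h : IsCentralLocalization S f) {s : R} (hs : s ∈ S) (y : R') :
    f s * y = y * f s := by
  obtain ⟨r, s', hs', e⟩ := h.surj y
  refine (h.isUnit s' hs').mul_left_cancel ?_
  have c (x : R) : s * x = x * s := (Set.mem_center_iff.1 (h.central s hs)).comm x
  rw [← mul_assoc, ← map_mul, ← c, map_mul, mul_assoc, e, ← map_mul, c, map_mul, ← e, mul_assoc]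

/-- The universal property of a central localization: a homomorphism that inverts `S` factors
through it. -/
theorem exists_lift (h : IsCentralLocalization S f) {Q : Type*} [Ring Q] [Algebra ℂ Q]
    (g : R →ₐ[ℂ] Q) (hg : ∀ s ∈ S, IsUnit (g s)) : ∃ k : R' →ₐ[ℂ] Q, ∀ r, k (f r) = g r := by
  -- The image of a fraction `y`, characterized by all of its representations at once.
  have key (y : R') : ∃ z : Q, ∀ s ∈ S, ∀ r, f s * y = f r → g s * z = g r := by
    obtain ⟨r, s, hs, e⟩ := h.surj y
    obtain ⟨a, ha⟩ := hg s hs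
    refine ⟨↑a⁻¹ * g r, fun s' hs' r' e' => ?_⟩
    have c (x : R) : s * x = x * s := (Set.mem_center_iff.1 (h.central s hs)).comm x
    have c' (x : R) : s' * x = x * s' := (Set.mem_center_iff.1 (h.central s' hs')).comm x
    have : f (s' * r) = f (s * r') := by
      rw [map_mul, ← e, map_mul, ← e', ← mul_assoc, ← mul_assoc, ← map_mul, ← map_mul, c]
    obtain ⟨t, ht, et⟩ := h.exists_of_eq _ _ this
    have e3 : g (s' * r) = g (s * r') :=
      (hg t ht).mul_left_cancel (by rw [← map_mul, et, map_mul])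
    refine a.isUnit.mul_left_cancel ?_
    rw [← mul_assoc, ha, ← map_mul, c, map_mul, mul_assoc, ← ha, a.mul_inv_cancel_left, ← map_mul,
      e3, map_mul, ha]
  choose k hk using key
  have uniq {y : R'} {z : Q} {s r : R} (hs : s ∈ S) (e : f s * y = f r) (e' : g s * z = g r) :
      k y = z := (hg s hs).mul_left_cancel ((hk y s hs r e).trans e'.symm)
  have kf (r : R) : k (f r) = g r := uniq S.one_mem (by simp) (by simp : g 1 * _ = g r)
  refine ⟨{ toFun := k, map_one' := ?_, map_mul' := ?_, map_zero' := ?_, map_add' := ?_,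
            commutes' := ?_ }, kf⟩
  · simpa using kf 1
  · intro y y'
    obtain ⟨r, s, hs, e⟩ := h.surj y
    obtain ⟨r', s', hs', e'⟩ := h.surj y'
    have gc : g s' * k y = k y * g s' := by
      refine (hg s hs).mul_left_cancel ?_
      have c' (x : R) : s' * x = x * s' := (Set.mem_center_iff.1 (h.central s' hs')).comm x
      rw [← mul_assoc, ← map_mul, ← c', map_mul, mul_assoc, hk y s hs r e, ← mul_assoc,
        hk y s hs r e, ← map_mul, ← map_mul, c']
    refine uniq (S.mul_mem hs hs') (r := r * r') ?_ ?_
    · rw [map_mul, mul_assoc, ← mul_assoc (f s'), h.map_comm hs', ← mul_assoc, ← mul_assoc, e,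
        mul_assoc, e', map_mul]
    · rw [map_mul, mul_assoc, ← mul_assoc (g s'), gc, ← mul_assoc, ← mul_assoc, hk y s hs r e,
        mul_assoc, hk y' s' hs' r' e', map_mul]
  · simpa using kf 0
  · intro y y'
    obtain ⟨r, s, hs, e⟩ := h.surj y
    obtain ⟨r', s', hs', e'⟩ := h.surj y'
    have c (x : R) : s * x = x * s := (Set.mem_center_iff.1 (h.central s hs)).comm x
    refine uniq (S.mul_mem hs hs') (r := s' * r + s * r') ?_ ?_
    · rw [mul_add, map_add, map_mul, map_mul, map_mul, ← e, ← e', ← mul_assoc, ← mul_assoc,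
        ← map_mul, ← map_mul, c]
    · rw [mul_add, map_add, map_mul, map_mul, map_mul, ← hk y s hs r e, ← hk y' s' hs' r' e',
        ← mul_assoc, ← mul_assoc, ← map_mul, ← map_mul, c]
  · intro c
    simpa using kf (algebraMap ℂ R c)

theorem hom_ext (h : IsCentralLocalization S f) {Q : Type*} [Ring Q] [Algebra ℂ Q]
    {k k' : R' →ₐ[ℂ] Q} (e : ∀ r, k (f r) = k' (f r)) (y : R') : k y = k' y := by
  obtain ⟨r, s, hs, hr⟩ := h.surj y
  refine ((h.isUnit s hs).map k).mul_left_cancel ?_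
  rw [← map_mul, hr, e r, e s, ← hr, map_mul]

end IsCentralLocalization

/-! ### Representations of finitely presented algebras -/

theorem evalAt_zero {l n : ℕ} (M : Fin (l + 1) → Mat n) : evalAt M 0 = 0 := by simp [evalAt]

theorem evalAt_add {l n : ℕ} (M : Fin (l + 1) → Mat n) (f g : FreeAlgebra ℂ (Fin l)) :
    evalAt M (f + g) = evalAt M f + evalAt M g := by simp [evalAt, mul_add]

theorem evalAt_smul {l n : ℕ} (M : Fin (l + 1) → Mat n) (c : ℂ) (f : FreeAlgebra ℂ (Fin l)) :
    evalAt M (c • f) = c • evalAt M f := by simp [evalAt]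

theorem evalAt_mul {l n : ℕ} {M : Fin (l + 1) → Mat n}
    (hM : ∀ i, M 0 * M i = M i ∧ M i * M 0 = M i) (f g : FreeAlgebra ℂ (Fin l)) :
    evalAt M (f * g) = evalAt M f * evalAt M g := by
  have comm : M 0 * FreeAlgebra.lift ℂ (fun i : Fin l => M i.succ) f
      = FreeAlgebra.lift ℂ (fun i : Fin l => M i.succ) f * M 0 := by
    induction f using FreeAlgebra.induction with
    | grade0 r => rw [AlgHom.commutes, Algebra.commutes]
    | grade1 i => simp [hM]
    | mul a b ha hb => rw [map_mul, ← mul_assoc, ha, mul_assoc, hb, mul_assoc]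
    | add a b ha hb => rw [map_add, mul_add, ha, hb, add_mul]
  simp only [evalAt, map_mul]
  rw [← mul_assoc, comm, mul_assoc, mul_assoc, ← mul_assoc (M 0) (M 0), (hM 0).1]

theorem evalAt_freeGen {l n : ℕ} {M : Fin (l + 1) → Mat n}
    (hM : ∀ i, M 0 * M i = M i ∧ M i * M 0 = M i) (i : Fin (l + 1)) :
    evalAt M (freeGen l i) = M i := by
  cases i using Fin.cases with
  | zero => simp [evalAt, freeGen]
  | succ i => simp [evalAt, freeGen, hM]

/-- Matrices that satisfy the relations define a ring-set-homomorphism: evaluation is multiplicative,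
so its kernel is a two-sided ideal. -/
theorem FinPresentation.exists_ringSetHom {R : Type u} [Ring R] [Algebra ℂ R]
    (P : FinPresentation R) {n : ℕ} {M : Fin (P.l + 1) → Mat n}
    (hM : ∀ i, M 0 * M i = M i ∧ M i * M 0 = M i) (hrel : ∀ j, evalAt M (P.rel j) = 0) :
    ∃ φ : RingSetHom R n, ∀ f, φ (P.π f) = evalAt M f := by
  let E : FreeAlgebra ℂ (Fin P.l) →ₙₐ[ℂ] Mat n :=
    { toFun := evalAt M, map_smul' := evalAt_smul M, map_zero' := evalAt_zero M,
      map_add' := evalAt_add M, map_mul' := evalAt_mul hM }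
  have hE (f) (h : P.π f = 0) : E f = 0 := by
    rw [← TwoSidedIdeal.mem_ker]
    refine (TwoSidedIdeal.span_le.2 ?_) ((P.ker f).1 h)
    rintro _ ⟨j, rfl⟩
    exact (TwoSidedIdeal.mem_ker E).2 (hrel j)
  have hE' (f g) (h : P.π f = P.π g) : E f = E g := by
    rw [← sub_eq_zero, ← map_sub]; exact hE _ (by rw [map_sub, h, sub_self])
  choose σ hσ using P.surj
  have key (f) : E (σ (P.π f)) = evalAt M f := hE' _ _ (hσ _)
  refine ⟨{ toFun := fun r => E (σ r), map_smul' := fun c r => ?_, map_zero' := ?_,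
            map_add' := fun r r' => ?_, map_mul' := fun r r' => ?_ }, key⟩
  · rw [MonoidHom.id_apply, ← map_smul]; exact hE' _ _ (by simp [hσ])
  · exact hE _ (hσ 0)
  · rw [← map_add]; exact hE' _ _ (by simp [hσ])
  · rw [← map_mul]; exact hE' _ _ (by simp [hσ])

namespace PresentationData

variable {A : Type v} {ℛ : GluingSystem.{u, v} A} (D : PresentationData ℛ) {n : ℕ}

theorem nonempty (hfp : ∀ α, Nonempty (FinPresentation (ℛ.R α))) :
    Nonempty (PresentationData ℛ) := by
  let P := fun α => (hfp α).some
  have hP (α) (r : ℛ.R α) : ∃ f, (P α).π f = r := (P α).surj r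
  choose σ hσ using hP
  have hfrac (α β) (y : ℛ.R₂ α β) : ∃ (f : _) (s : ℛ.S β α),
      ℛ.glue α β y * ℛ.loc β α s = ℛ.loc β α ((P β).π f) := by
    obtain ⟨r, s, hs, e⟩ := (ℛ.isLoc β α).surj (ℛ.glue α β y)
    exact ⟨σ β r, ⟨s, hs⟩, by rw [hσ, ← e, (ℛ.isLoc β α).map_comm hs]⟩
  have hinv (α β) (s : ℛ.S α β) : ∃ (f : _) (t : ℛ.S β α),
      ℛ.loc β α ((P β).π f) * ℛ.glue α β (ℛ.loc α β (s : ℛ.R α)) = ℛ.loc β α t := by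
    obtain ⟨a, ha⟩ := ((ℛ.isLoc α β).isUnit s s.2)
    obtain ⟨f, t, e⟩ := hfrac α β ↑a⁻¹
    refine ⟨f, t, ?_⟩
    rw [← e, ← (ℛ.isLoc β α).map_comm t.2, mul_assoc, ← map_mul, ← ha, a.inv_mul, map_one, mul_one]
  choose tg ts h using hfrac
  choose tgS tsS h' using hinv
  exact ⟨{ pres := P, lift := fun α β s => σ α s, π_lift := fun α β s => hσ α s,
           tg := fun α β i => tg α β (ℛ.loc α β ((P α).π (freeGen _ i)))
           ts := fun α β i => ts α β (ℛ.loc α β ((P α).π (freeGen _ i)))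
           t_spec := fun α β i => h _ _ _, tgS := tgS, tsS := tsS, tS_spec := h' }⟩

theorem mat_coords (φ : ∀ α, RingSetHom (ℛ.R α) n) (α : A) (i) :
    D.mat (D.coords n φ) α i = φ α ((D.pres α).π (freeGen _ i)) := rfl

theorem mat_coords_zero (φ : ∀ α, RingSetHom (ℛ.R α) n) (α : A) :
    D.mat (D.coords n φ) α 0 = φ α 1 := by
  rw [mat_coords]; simp [freeGen]

/-- At the point given by `φ`, the value of a noncommutative polynomial is the image under `φ` of
the element of the chart that it represents. -/
theorem evalAt_coords (φ : ∀ α, RingSetHom (ℛ.R α) n) (α : A) (f) :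
    evalAt (D.mat (D.coords n φ) α) f = φ α ((D.pres α).π f) := by
  have hM (i) : D.mat (D.coords n φ) α 0 * D.mat (D.coords n φ) α i = D.mat (D.coords n φ) α i ∧
      D.mat (D.coords n φ) α i * D.mat (D.coords n φ) α 0 = D.mat (D.coords n φ) α i := by
    rw [mat_coords_zero, mat_coords, ← map_mul, ← map_mul, one_mul, mul_one]; simp
  induction f using FreeAlgebra.induction with
  | grade0 r =>
    rw [AlgHom.commutes, Algebra.algebraMap_eq_smul_one, Algebra.algebraMap_eq_smul_one,
      evalAt_smul, map_smul, ← mat_coords_zero D]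
    congr 1; simp [evalAt]
  | grade1 i => exact evalAt_freeGen hM i.succ
  | mul a b ha hb => rw [evalAt_mul hM, ha, hb, map_mul, map_mul]
  | add a b ha hb => rw [evalAt_add, ha, hb, map_add, map_add]

theorem im_coords (φ : ∀ α, RingSetHom (ℛ.R α) n) (α : A) :
    D.im (D.coords n φ) α = Set.range (φ α) := by
  ext m; constructor
  · rintro ⟨f, rfl⟩; exact ⟨_, (D.evalAt_coords φ α f).symm⟩
  · rintro ⟨r, rfl⟩
    obtain ⟨f, rfl⟩ := (D.pres α).surj r
    exact ⟨f, D.evalAt_coords φ α f⟩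

theorem coords_injective : Function.Injective (D.coords n) := by
  intro φ ψ h
  funext α
  ext r
  obtain ⟨f, rfl⟩ := (D.pres α).surj r
  rw [← evalAt_coords, h, evalAt_coords]

theorem range_coords : Set.range (D.coords n) = D.rep n := by
  ext x; constructor
  · rintro ⟨φ, rfl⟩ α
    refine ⟨fun i => ?_, fun j => ?_⟩
    · rw [mat_coords_zero, mat_coords, ← map_mul, ← map_mul, one_mul, mul_one]; simp
    · rw [evalAt_coords, ((D.pres α).ker _).2 (TwoSidedIdeal.subset_span ⟨j, rfl⟩), map_zero]
  · intro hx
    choose φ hφ using fun α => (D.pres α).exists_ringSetHom (hx α).1 (hx α).2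
    refine ⟨φ, ?_⟩
    funext ⟨α, i, j, k⟩
    change φ α _ j k = _
    rw [hφ, evalAt_freeGen (hx α).1]
    rfl

end PresentationData

theorem mul_mul_mul_of_central {G : Type*} [Semigroup G] {e : G} (he : ∀ x, e * x = x * e)
    (f a b : G) : f * a * (e * b) = e * f * (a * b) := by
  rw [mul_assoc, ← mul_assoc a, ← he a, mul_assoc, ← mul_assoc f, ← he f]

/-! ### Central idempotents and inclusion–exclusion -/

section InclusionExclusion

variable {A : Type v} [Fintype A] [LinearOrder A] {T : Type w} [Ring T] [Algebra ℂ T]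

/-- The commutative case, with products written over sorted lists. -/
theorem eq_sum_of_prod_one_sub_eq_zero {C : Type w} [CommRing C] [Algebra ℂ C] {e : A → C}
    (h : ∏ α, (1 - e α) = 0) :
    (1 : C) = ∑ K ∈ (Finset.univ : Finset A).powerset with K.Nonempty,
      (-1 : ℂ) ^ (K.card + 1) • ((K.sort (· ≤ ·)).map e).prod := by
  have hfil : (Finset.univ : Finset A).powerset.filter (fun K => K.Nonempty)
      = (Finset.univ : Finset A).powerset.erase ∅ := by
    ext K; simp [Finset.nonempty_iff_ne_empty]
  rw [Finset.prod_sub, ← Finset.add_sum_erase _ _ (Finset.empty_mem_powerset _)] at h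
  have h3 := eq_neg_of_add_eq_zero_left h
  simp only [Finset.card_empty, pow_zero, Finset.prod_empty, Finset.prod_const_one, mul_one,
    Finset.sdiff_empty] at h3
  rw [h3, ← Finset.sum_neg_distrib, hfil]
  refine Finset.sum_congr rfl fun K _ => ?_
  have hK : ((K.sort (· ≤ ·)).map e).prod = ∏ α ∈ K, e α := by
    rw [Finset.prod, ← Finset.sort_eq K (· ≤ ·), Multiset.map_coe, Multiset.prod_coe]
  rw [pow_succ, hK, Algebra.smul_def]
  simp

/-- Central idempotents that generate the unit ideal satisfy the inclusion–exclusion identity,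
which is the expansion of `∏ (1 - e α) = 0`. -/
theorem eq_sum_of_iSup_span_eq_top {e : A → T} (he : ∀ α, e α * e α = e α)
    (hc : ∀ α x, e α * x = x * e α) (h : ⨆ α, Ideal.span {e α} = ⊤) :
    (1 : T) = ∑ K ∈ (Finset.univ : Finset A).powerset with K.Nonempty,
      (-1 : ℂ) ^ (K.card + 1) • ((K.sort (· ≤ ·)).map e).prod := by
  let c (α) : Subalgebra.center ℂ T :=
    ⟨e α, Subalgebra.mem_center_iff.2 fun x => (hc α x).symm⟩
  have hcc (α) : c α * (1 - c α) = 0 := Subtype.ext (by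
    change e α * (1 - e α) = 0
    rw [mul_sub, mul_one, he, sub_self])
  have h0 : ∏ α, (1 - c α) = 0 := by
    have hle : ⨆ α, Ideal.span {e α} ≤ LinearMap.ker
        (LinearMap.toSpanSingleton T T ((∏ α, (1 - c α) : Subalgebra.center ℂ T) : T)) := by
      refine iSup_le fun α => (Ideal.span_singleton_le_iff_mem _).2 ?_
      rw [LinearMap.mem_ker, LinearMap.toSpanSingleton_apply, smul_eq_mul]
      change ((c α * ∏ α, (1 - c α) : Subalgebra.center ℂ T) : T) = 0
      rw [← Finset.mul_prod_erase _ _ (Finset.mem_univ α), ← mul_assoc]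
      have := congrArg (fun y => ((y * ∏ x ∈ Finset.univ.erase α, (1 - c x) :
        Subalgebra.center ℂ T) : T)) (hcc α)
      simpa using this
    have h1 := hle (h ▸ Submodule.mem_top : (1 : T) ∈ _)
    rw [LinearMap.mem_ker, LinearMap.toSpanSingleton_apply, one_smul] at h1
    exact Subtype.ext h1
  have h3 := congrArg (Subalgebra.center ℂ T).val (eq_sum_of_prod_one_sub_eq_zero h0)
  rw [map_one, map_sum] at h3
  rw [h3]
  refine Finset.sum_congr rfl fun K _ => ?_
  rw [map_smul, map_list_prod, List.map_map]
  rfl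

/-- Conversely, the inclusion–exclusion identity expresses `1` by products that lie in every left
ideal containing the `e α`. -/
theorem eq_top_of_eq_sum {e : A → T}
    (h : (1 : T) = ∑ K ∈ (Finset.univ : Finset A).powerset with K.Nonempty,
      (-1 : ℂ) ^ (K.card + 1) • ((K.sort (· ≤ ·)).map e).prod)
    (J : Ideal T) (hJ : ∀ α, e α ∈ J) : J = ⊤ := by
  rw [Ideal.eq_top_iff_one, h]
  have hl (l : List A) (hl : l ≠ []) : (l.map e).prod ∈ J := by
    induction l with
    | nil => exact absurd rfl hl
    | cons a l ih =>
      by_cases h : l = []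
      · simpa [h] using hJ a
      · simpa using J.mul_mem_left _ (ih h)
  refine J.sum_mem fun K hK => ?_
  rw [Algebra.smul_def]
  refine J.mul_mem_left _ (hl _ fun h0 => ?_)
  have := (Finset.mem_filter.1 hK).2
  rw [← Finset.sort_toFinset K (· ≤ ·), h0] at this
  simp at this

end InclusionExclusion

namespace IsCentralLocalization

variable {T : Type u} {Q : Type w} [Ring T] [Algebra ℂ T] [Ring Q] [Algebra ℂ Q]
  {N : Submonoid T} {p : T →ₐ[ℂ] Q} {sec : Q →ₙₐ[ℂ] T}

theorem exists_mul_section_one (h : IsCentralLocalization N p) (hp : ∀ y, p (sec y) = y) :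
    ∃ s ∈ N, s * sec 1 = s := by
  obtain ⟨s, hs, e⟩ := h.exists_of_eq (sec 1) 1 (by rw [hp, map_one])
  exact ⟨s, hs, by rw [e, mul_one]⟩

theorem exists_inverse (h : IsCentralLocalization N p)
    (hs : ∀ x, sec (p x) = sec 1 * x) {s : T} (hsN : s ∈ N) : ∃ u, u * s = sec 1 := by
  obtain ⟨a, ha⟩ := h.isUnit s hsN
  refine ⟨sec ↑a⁻¹, ?_⟩
  have h1 : sec (↑a⁻¹ * p s) = sec 1 := by rw [← ha, a.inv_mul]
  rw [← h1, map_mul, hs, ← mul_assoc, ← map_mul, mul_one]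

/-- If a central localization is realized as a ring-subset of the original algebra, then the unit
of this ring-subset is central. -/
theorem section_one_mem_center (h : IsCentralLocalization N p) (hp : ∀ y, p (sec y) = y)
    (hs : ∀ x, sec (p x) = sec 1 * x) (x : T) : sec 1 * x = x * sec 1 := by
  obtain ⟨s, hsN, se⟩ := h.exists_mul_section_one hp
  obtain ⟨u, hu⟩ := h.exists_inverse hs hsN
  have c (x : T) : s * x = x * s := (Set.mem_center_iff.1 (h.central s hsN)).comm x
  have h1 : x * sec 1 = s * (x * u) := by rw [← hu, ← c, ← mul_assoc, ← c, mul_assoc]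
  have h2 : sec 1 * (x * sec 1) = x * sec 1 := by
    rw [h1, ← mul_assoc, ← c, se]
  rw [← h2, ← mul_assoc, ← hs, ← map_mul, mul_one]

end IsCentralLocalization

namespace PresentationData

variable {A : Type v} {ℛ : GluingSystem.{u, v} A} (D : PresentationData ℛ) {n : ℕ}

/-- A tuple that represents a morphism gives a point of the locus. The units of the ring-subsets
realizing the localizations are central idempotents of `T`, and an element of `N α` becomes
invertible in `e_α T`. -/
theorem isInLocus_of_representsMorphism [Fintype A] [LinearOrder A]
    {φ : ∀ α, RingSetHom (ℛ.R α) n} (hφ : RepresentsMorphism ℛ n φ) :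
    D.IsInLocus n (D.coords n φ) := by
  obtain ⟨T, 𝒮, c, Φ, sec, hp, hs, hΦ, hφ⟩ := hφ
  obtain ⟨q, k, hadm, hk, hglue, hq, hφ⟩ : ∃ (q : ∀ α, ℛ.R α →ₐ[ℂ] 𝒮.R α)
      (k : ∀ α β, ℛ.R₂ α β →ₐ[ℂ] 𝒮.R₂ α β),
      (∀ α β, ∀ s ∈ ℛ.S α β, q α s ∈ 𝒮.S α β) ∧
      (∀ α β x, k α β (ℛ.loc α β x) = 𝒮.loc α β (q α x)) ∧
      (∀ α β y, k β α (ℛ.glue α β y) = 𝒮.glue α β (k α β y)) ∧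
      (∀ α, Function.Surjective (q α)) ∧ (∀ α r, φ α r = ((sec α (q α r) : T) : Mat n)) :=
    ⟨Φ.map, Φ.map₂, Φ.admissible, Φ.map₂_loc, Φ.map₂_glue, hΦ, hφ⟩
  have hloc (α β) (r : ℛ.R α) :
      k α β (ℛ.loc α β r) = 𝒮.loc α β (c.p α (sec α (q α r))) := by rw [hk, hp]
  have hgl (α β) (r : ℛ.R α) : k β α (ℛ.glue α β (ℛ.loc α β r)) =
      𝒮.loc β α (c.p β (sec α (q α r))) := by rw [hglue, hloc, c.glue_loc]
  have hφ1 (α) : φ α 1 = ((sec α 1 : T) : Mat n) := by rw [hφ, map_one]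
  have cen (α) (x : T) : sec α 1 * x = x * sec α 1 :=
    (c.isLoc α).section_one_mem_center (hp α) (hs α) x
  have mem_im (α) (x : T) : ((sec α 1 * x : T) : Mat n) ∈ Set.range (φ α) := by
    obtain ⟨r, hr⟩ := hq α (c.p α x)
    exact ⟨r, by rw [hφ, hr, hs]⟩
  have unit_mul (α) (r : ℛ.R α) : sec α 1 * sec α (q α r) = sec α (q α r) := by
    rw [← map_mul, one_mul]
  -- Equality on the overlap of `α` and `β` is equality after multiplication by both units.
  have key (α β) (y y' : T)
      (h : 𝒮.loc β α (c.p β y) = 𝒮.loc β α (c.p β y')) :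
      sec α 1 * sec β 1 * y = sec α 1 * sec β 1 * y' := by
    obtain ⟨t, ht, e⟩ := (𝒮.isLoc β α).exists_of_eq _ _ h
    rw [c.overlap] at ht
    obtain ⟨t, ht, rfl⟩ := ht
    obtain ⟨u, hu⟩ := (c.isLoc α).exists_inverse (hs α) ht
    have e' := congrArg (sec β) e
    change sec β (c.p β t * c.p β y) = sec β (c.p β t * c.p β y') at e'
    rw [← map_mul, ← map_mul, hs, hs] at e'
    have h2 (z : T) : sec α 1 * sec β 1 * z = u * (sec β 1 * (t * z)) := by
      rw [cen α (sec β 1), ← hu, mul_assoc, mul_assoc, ← mul_assoc (sec β 1), cen β u, mul_assoc]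
    rw [h2, h2, e']
  refine ⟨D.range_coords ▸ Set.mem_range_self φ, ?_, ?_, ?_, ?_, ?_, ?_, ?_⟩
  · intro α β i
    rw [mat_coords_zero, mat_coords, hφ1, hφ, ← Subalgebra.coe_mul, cen, Subalgebra.coe_mul]
  · have hsub (α β) : (fun m => φ α 1 * m) '' Set.range (φ β) ⊆
        (fun m => φ β 1 * m) '' Set.range (φ α) := by
      rintro _ ⟨_, ⟨r, rfl⟩, rfl⟩
      refine ⟨_, mem_im α (sec β (q β r)), ?_⟩
      change φ β 1 * _ = φ α 1 * φ β r
      rw [hφ1, hφ1, hφ, ← Subalgebra.coe_mul, ← mul_assoc, cen β (sec α 1), mul_assoc, unit_mul,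
        Subalgebra.coe_mul]
    intro α β
    rw [mat_coords_zero, mat_coords_zero, im_coords, im_coords]
    exact (hsub α β).antisymm (hsub β α)
  · intro α β
    rw [mat_coords_zero, mat_coords_zero, im_coords, hφ1, hφ1, ← Subalgebra.coe_mul]
    exact mem_im _ _
  · simp only [mat_coords_zero, hφ1]
    have h1 := eq_sum_of_iSup_span_eq_top (e := fun α => sec α 1)
      (fun α => by rw [← map_mul, mul_one]) cen (c.cover _ fun α => by
        obtain ⟨s, hs, e⟩ := (c.isLoc α).exists_mul_section_one (hp α)
        exact ⟨s, hs, Ideal.mem_span_singleton'.2 ⟨s, e⟩⟩)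
    have h2 := congrArg T.val h1
    rw [map_one, map_sum] at h2
    rw [h2]
    refine Finset.sum_congr rfl fun K _ => ?_
    rw [map_smul, map_list_prod, List.map_map]
    rfl
  · intro α β s m hm
    rw [im_coords] at hm
    obtain ⟨r, rfl⟩ := hm
    rw [evalAt_coords, π_lift, mat_coords_zero, hφ1, ← map_mul, hφ, hφ, map_mul,
      ← Subalgebra.coe_mul]
    intro h
    have ht := hadm α β s s.2
    rw [c.overlap] at ht
    obtain ⟨t, ht, e⟩ := ht
    obtain ⟨u, hu⟩ := (c.isLoc β).exists_inverse (hs β) ht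
    have e' : c.p α t = q α s := e
    rw [← e', map_mul, hs, cen, mul_assoc, unit_mul, ZeroMemClass.coe_eq_zero] at h
    rw [← hu, mul_assoc, h, mul_zero, ZeroMemClass.coe_zero]
  · intro α β i
    rw [mat_coords_zero, mat_coords_zero, mat_coords, evalAt_coords, evalAt_coords, π_lift]
    have h := congrArg (k β α) (D.t_spec α β i)
    rw [map_mul, hgl, hloc, hloc, ← map_mul, ← map_mul] at h
    have h' := key α β _ _ h
    simp only [hφ, map_one, ← Subalgebra.coe_mul]
    refine congrArg Subtype.val (Eq.trans ?_ (h'.trans ?_))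
    · exact mul_mul_mul_of_central (cen α) _ _ _
    · rw [mul_assoc, unit_mul]
  · intro α β s
    rw [mat_coords_zero, mat_coords_zero, evalAt_coords, evalAt_coords, evalAt_coords, π_lift,
      π_lift]
    have h := congrArg (k β α) (D.tS_spec α β s)
    rw [map_mul, hgl, hloc, hloc, ← map_mul, ← map_mul] at h
    have h' := key α β _ _ h
    simp only [hφ, map_one, ← Subalgebra.coe_mul]
    refine congrArg Subtype.val (Eq.trans ?_ (h'.symm.trans ?_))
    · rw [mul_assoc, ← mul_assoc (sec α 1) (sec α 1), ← map_mul, mul_one, ← mul_assoc, cen β]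
    · rw [mul_assoc (sec α 1), ← mul_assoc (sec β 1), cen β, mul_assoc, ← mul_assoc]

end PresentationData

/-! ### The gluing system of a family of central idempotents -/

section Cutoff

variable {T : Type w} [Ring T] [Algebra ℂ T]

/-- The congruence `e x = e y` for a central element `e`. -/
def cutoffCon (e : Submonoid.center T) : RingCon T where
  r x y := (e : T) * x = e * y
  iseqv := ⟨fun _ => rfl, fun h => h.symm, fun h h' => h.trans h'⟩
  add' h h' := by simp only [mul_add]; rw [h, h']
  mul' {x y x' y'} h h' := by
    have c := (Submonoid.mem_center_iff.1 e.2)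
    rw [← mul_assoc, h, mul_assoc, ← mul_assoc _ y, ← c y, mul_assoc, h', ← mul_assoc, c, mul_assoc]

/-- For a central idempotent `e`, the quotient `T / (1 - e) ≅ e T` of `T`. -/
abbrev Cutoff (e : Submonoid.center T) : Type w := (cutoffCon e).Quotient

/-- The quotient map `T → T / (1 - e)`. -/
def cutoff (e : Submonoid.center T) : T →ₐ[ℂ] Cutoff e := (cutoffCon e).mkₐ ℂ

theorem cutoff_surjective (e : Submonoid.center T) : Function.Surjective (cutoff e) :=
  fun y => RingCon.mkₐ_surjective _ y

theorem cutoff_eq_iff {e : Submonoid.center T} {x y : T} :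
    cutoff e x = cutoff e y ↔ (e : T) * x = e * y := (cutoffCon e).eq

theorem cutoff_self {e : Submonoid.center T} (he : IsIdempotentElem e) :
    cutoff e (e : T) = 1 := by
  rw [← map_one (cutoff e), cutoff_eq_iff, mul_one]
  exact congrArg Subtype.val he

/-- The canonical map `T / (1 - e) → T / (1 - e')` if `e'` is a multiple of `e`. -/
def cutoffMap {e e' : Submonoid.center T} (h : ∃ c, e' = c * e) : Cutoff e →ₐ[ℂ] Cutoff e' :=
  (cutoffCon e).liftₐ (cutoff e') (by
    obtain ⟨c, rfl⟩ := h
    intro x y hxy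
    refine cutoff_eq_iff.2 ?_
    have hxy : (e : T) * x = e * y := hxy
    simp [mul_assoc, hxy])

@[simp]
theorem cutoffMap_cutoff {e e' : Submonoid.center T} (h : ∃ c, e' = c * e) (x : T) :
    cutoffMap h (cutoff e x) = cutoff e' x := rfl

/-- The identification of the quotients at equal idempotents. -/
def cutoffCongr {e e' : Submonoid.center T} (h : e = e') : Cutoff e ≃ₐ[ℂ] Cutoff e' :=
  AlgEquiv.ofAlgHom (cutoffMap ⟨1, by rw [h, one_mul]⟩) (cutoffMap ⟨1, by rw [h, one_mul]⟩)
    (AlgHom.ext ((cutoff_surjective e').forall.2 fun _ => rfl))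
    (AlgHom.ext ((cutoff_surjective e).forall.2 fun _ => rfl))

/-- The largest multiplicatively closed subset of the center of `T` at which `T / (1 - e)` is a
localization: the central elements that become invertible in `T / (1 - e)`. -/
def unitsOn (e : Submonoid.center T) : Submonoid T :=
  Submonoid.center T ⊓ (IsUnit.submonoid (Cutoff e)).comap (cutoff e)

theorem mem_unitsOn {e : Submonoid.center T} {t : T} :
    t ∈ unitsOn e ↔ t ∈ Submonoid.center T ∧ IsUnit (cutoff e t) := Iff.rfl

theorem coe_mem_unitsOn {e : Submonoid.center T} (he : IsIdempotentElem e) :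
    (e : T) ∈ unitsOn e := mem_unitsOn.2 ⟨e.2, by rw [cutoff_self he]; exact isUnit_one⟩

theorem isCentralLocalization_cutoff {e : Submonoid.center T} (he : IsIdempotentElem e) :
    IsCentralLocalization (unitsOn e) (cutoff e) where
  central _ hs := hs.1
  isUnit _ hs := hs.2
  surj y := by
    obtain ⟨x, rfl⟩ := cutoff_surjective e y
    exact ⟨x, 1, Submonoid.one_mem _, by simp⟩
  exists_of_eq x y h := ⟨e, coe_mem_unitsOn he, cutoff_eq_iff.1 h⟩

/-- The localizations onto double and triple overlaps are of this form: the passage from `e T` to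
`e f T` inverts the central elements that are invertible on `f T`. -/
theorem isCentralLocalization_cutoffMap {e e' f : Submonoid.center T} (hf : IsIdempotentElem f)
    (h : ∃ c, e' = c * e) (h' : e' = e * f) :
    IsCentralLocalization ((unitsOn f).map (cutoff e)) (cutoffMap h) where
  central := by
    rintro _ ⟨t, ht, rfl⟩
    refine Semigroup.mem_center_iff.2 ((cutoff_surjective e).forall.2 fun x => ?_)
    change cutoff e x * cutoff e t = cutoff e t * cutoff e x
    rw [← map_mul, ← map_mul, Submonoid.mem_center_iff.1 ht.1]
  isUnit := by
    rintro _ ⟨t, ht, rfl⟩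
    have := (mem_unitsOn.1 ht).2.map (cutoffMap ⟨e, h'⟩ : Cutoff f →ₐ[ℂ] Cutoff e')
    exact this
  surj := (cutoff_surjective e').forall.2 fun x =>
    ⟨cutoff e x, 1, Submonoid.one_mem _, by simp⟩
  exists_of_eq := by
    refine (cutoff_surjective e).forall₂.2 fun x y hxy => ?_
    rw [cutoffMap_cutoff, cutoffMap_cutoff, cutoff_eq_iff, h'] at hxy
    refine ⟨cutoff e f, ⟨f, coe_mem_unitsOn hf, rfl⟩, ?_⟩
    rw [← map_mul, ← map_mul, cutoff_eq_iff]
    simpa [mul_assoc] using hxy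

/-- The embedding of `T / (1 - e)` onto the ring-subset `e T` of `T`. -/
noncomputable def cutoffSection {e : Submonoid.center T} (he : IsIdempotentElem e) :
    Cutoff e →ₙₐ[ℂ] T :=
  have key (x : T) : (e : T) * Function.surjInv (cutoff_surjective e) (cutoff e x) = e * x :=
    cutoff_eq_iff.1 (Function.surjInv_eq (cutoff_surjective e) _)
  { toFun := fun y => (e : T) * Function.surjInv (cutoff_surjective e) y
    map_smul' := fun c => (cutoff_surjective e).forall.2 fun x => by
      rw [← map_smul, key, key, mul_smul_comm]; rfl
    map_zero' := by rw [← map_zero (cutoff e), key, mul_zero]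
    map_add' := (cutoff_surjective e).forall₂.2 fun x y => by
      rw [← map_add, key, key, key, mul_add]
    map_mul' := (cutoff_surjective e).forall₂.2 fun x y => by
      have c := (Submonoid.mem_center_iff.1 e.2)
      have he' : (e : T) * e = e := congrArg Subtype.val he
      rw [← map_mul, key, key, key, mul_assoc, ← mul_assoc x, c x, ← mul_assoc, ← mul_assoc,
        ← mul_assoc (e : T) (e : T), he'] }

theorem cutoffSection_cutoff {e : Submonoid.center T} (he : IsIdempotentElem e) (x : T) :
    cutoffSection he (cutoff e x) = e * x :=
  cutoff_eq_iff.1 (Function.surjInv_eq (cutoff_surjective e) _)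

/-- A left ideal that contains an element invertible on `e T` contains `e`. -/
theorem isCentralCover_unitsOn {A : Type v} {e : A → Submonoid.center T}
    (h : ∀ J : Ideal T, (∀ α, (e α : T) ∈ J) → J = ⊤) :
    IsCentralCover fun α => unitsOn (e α) := by
  intro I hI
  refine h _ fun α => Submodule.mem_iSup_of_mem α ?_
  obtain ⟨s, hs, hsI⟩ := hI α
  obtain ⟨a, ha⟩ := (mem_unitsOn.1 hs).2
  obtain ⟨u, hu⟩ := cutoff_surjective _ (↑a⁻¹ : Cutoff (e α))
  have h1 : cutoff (e α) (u * s) = cutoff (e α) 1 := by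
    rw [map_mul, hu, ← ha, a.inv_mul, map_one]
  rw [cutoff_eq_iff, mul_one] at h1
  rw [← h1, ← mul_assoc]
  exact (I α).mul_mem_left _ hsI

theorem IsCentralCover.map {A : Type v} {N : A → Submonoid T} (h : IsCentralCover N) {Q : Type*}
    [Ring Q] [Algebra ℂ Q] (p : T →ₐ[ℂ] Q) :
    IsCentralCover fun α => (N α).map p := by
  intro I hI
  have h1 := h (fun α => (I α).comap p) fun α => by
    obtain ⟨_, ⟨s, hs, rfl⟩, hsI⟩ := hI α
    exact ⟨s, hs, hsI⟩
  have h2 : ⨆ α, (I α).comap p ≤ (⨆ α, I α).comap p :=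
    iSup_le fun α => Ideal.comap_mono (le_iSup I α)
  rw [h1] at h2
  rw [Ideal.eq_top_iff_one, ← map_one p]
  exact h2 Submodule.mem_top

/-- The gluing system of the cover of `T` by the quotients `T / (1 - e α) ≅ e α T`. -/
def idempotentGluing {A : Type v} (e : A → Submonoid.center T) (he : ∀ α, IsIdempotentElem (e α))
    (h : ∀ J : Ideal T, (∀ α, (e α : T) ∈ J) → J = ⊤) : GluingSystem.{w, v} A where
  R α := Cutoff (e α)
  R₂ α β := Cutoff (e α * e β)
  S α β := (unitsOn (e β)).map (cutoff (e α))
  loc α β := cutoffMap ⟨e β, mul_comm _ _⟩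
  isLoc α β := isCentralLocalization_cutoffMap (he β) _ rfl
  cover α := (isCentralCover_unitsOn h).map _
  loc_self α := by
    constructor
    · refine (cutoff_surjective _).forall₂.2 fun x y hxy => ?_
      rw [cutoffMap_cutoff, cutoffMap_cutoff, cutoff_eq_iff, (he α).eq] at hxy
      exact cutoff_eq_iff.2 hxy
    · exact (cutoff_surjective _).forall.2 fun x => ⟨cutoff _ x, rfl⟩
  glue α β := cutoffCongr (mul_comm _ _)
  glue_symm α β := AlgEquiv.ext ((cutoff_surjective _).forall.2 fun _ => rfl)
  glue_self α := AlgEquiv.ext ((cutoff_surjective _).forall.2 fun _ => rfl)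
  R₃ α β γ := Cutoff (e α * e β * e γ)
  loc₃ α β γ := cutoffMap ⟨e γ, mul_comm _ _⟩
  isLoc₃ α β γ := by
    have h1 : ((unitsOn (e γ)).map (cutoff (e α))).map
        (cutoffMap ⟨e β, mul_comm _ _⟩ : Cutoff (e α) →ₐ[ℂ] Cutoff (e α * e β)) =
        (unitsOn (e γ)).map (cutoff (e α * e β)) :=
      SetLike.coe_injective (Set.image_image _ _ _)
    rw [h1]
    exact isCentralLocalization_cutoffMap (he γ) _ rfl
  swap α β γ := cutoffCongr (mul_right_comm _ _ _)
  swap_loc α β γ := (cutoff_surjective _).forall.2 fun _ => rfl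
  glue₃ α β γ := cutoffCongr (by rw [mul_comm (e α)])
  glue₃_loc α β γ := (cutoff_surjective _).forall.2 fun _ => rfl
  cocycle α β γ := (cutoff_surjective _).forall.2 fun _ => rfl

end Cutoff

/-! ### The surrogate of the point determined by a point of the locus -/

/-- A central element `s` acts injectively on the block `f φ(R)` if and only if it is invertible
there: the block is finite-dimensional. -/
theorem RingSetHom.injective_iff_exists_inverse {R : Type u} [Ring R] [Algebra ℂ R] {n : ℕ}
    (φ : RingSetHom R n) {f : Mat n} (hf : f * f = f) (hc : ∀ r, f * φ r = φ r * f)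
    (hm : f * φ 1 ∈ Set.range φ) {s : R} (hs : s ∈ Set.center R) :
    (∀ r, φ s * φ r = 0 → f * φ r = 0) ↔ ∃ r, φ s * (f * φ r) = f * φ 1 := by
  have c (x : R) : s * x = x * s := (Set.mem_center_iff.1 hs).comm x
  constructor
  · intro h
    obtain ⟨w, hw⟩ := hm
    have hwr (r : R) : f * φ r = φ (w * r) := by
      rw [map_mul, hw, mul_assoc, ← map_mul, one_mul]
    let V : Submodule ℂ (Mat n) :=
      LinearMap.range ((LinearMap.mulLeft ℂ f).comp (φ : R →ₗ[ℂ] Mat n))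
    have hV (v : Mat n) (hv : v ∈ V) : LinearMap.mulLeft ℂ (φ s) v ∈ V := by
      obtain ⟨r, rfl⟩ := hv
      refine ⟨s * r, ?_⟩
      change f * φ (s * r) = φ s * (f * φ r)
      rw [map_mul, ← mul_assoc, hc, mul_assoc]
    have hinj : Function.Injective ((LinearMap.mulLeft ℂ (φ s)).restrict hV) := by
      rw [injective_iff_map_eq_zero]
      rintro ⟨_, ⟨r, rfl⟩⟩ h0
      have h1 : φ s * (f * φ r) = 0 := congrArg Subtype.val h0
      have h2 := h (w * r) (by rw [← hwr, h1])
      rw [← hwr, ← mul_assoc, hf] at h2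
      exact Subtype.ext h2
    obtain ⟨⟨_, ⟨r, rfl⟩⟩, hr⟩ := LinearMap.injective_iff_surjective.1 hinj ⟨f * φ 1, 1, rfl⟩
    exact ⟨r, congrArg Subtype.val hr⟩
  · rintro ⟨r, hr⟩ r' h
    have : f * φ r' = f * φ r * (φ s * φ r') := by
      rw [← mul_assoc, mul_assoc f, ← map_mul, ← c, map_mul, ← mul_assoc f, hc s, mul_assoc (φ s),
        hr, mul_assoc, ← map_mul, one_mul]
    rw [this, h, mul_zero]

/-- The subalgebra of `M_n(ℂ)` of those `x` that commute with all units `φ_α(1)` and whose blocks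
`φ_α(1) x` belong to the images of the `φ_α`. -/
def blockAlgebra {A : Type v} {R : A → Type u} [∀ α, Ring (R α)] [∀ α, Algebra ℂ (R α)] {n : ℕ}
    (φ : ∀ α, RingSetHom (R α) n) : Subalgebra ℂ (Mat n) where
  carrier := {x | ∀ α, φ α 1 * x = x * φ α 1 ∧ φ α 1 * x ∈ Set.range (φ α)}
  mul_mem' {x y} hx hy α := by
    obtain ⟨cx, rx, hx⟩ := hx α
    obtain ⟨cy, ry, hy⟩ := hy α
    refine ⟨by rw [← mul_assoc, cx, mul_assoc, cy, mul_assoc], rx * ry, ?_⟩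
    rw [map_mul, hx, hy, mul_assoc, ← mul_assoc x, ← cx, mul_assoc, ← mul_assoc, ← map_mul,
      one_mul]
  add_mem' {x y} hx hy α := by
    obtain ⟨cx, rx, hx⟩ := hx α
    obtain ⟨cy, ry, hy⟩ := hy α
    exact ⟨by rw [mul_add, add_mul, cx, cy], rx + ry, by rw [map_add, hx, hy, mul_add]⟩
  algebraMap_mem' c α := by
    refine ⟨(Algebra.commutes _ _).symm, c • 1, ?_⟩
    rw [map_smul, ← Algebra.commutes, Algebra.smul_def]

theorem mem_blockAlgebra {A : Type v} {R : A → Type u} [∀ α, Ring (R α)] [∀ α, Algebra ℂ (R α)]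
    {n : ℕ} {φ : ∀ α, RingSetHom (R α) n} {x : Mat n} : x ∈ blockAlgebra φ ↔
      ∀ α, φ α 1 * x = x * φ α 1 ∧ φ α 1 * x ∈ Set.range (φ α) := Iff.rfl

namespace PresentationData

variable {A : Type v} {ℛ : GluingSystem.{u, v} A} (D : PresentationData ℛ) {n : ℕ}

/-- A matrix that commutes with the generators commutes with the image of the chart. -/
theorem commute_of_mat {φ : ∀ α, RingSetHom (ℛ.R α) n} {β : A} {x : Mat n}
    (h : ∀ i, x * D.mat (D.coords n φ) β i = D.mat (D.coords n φ) β i * x) (r : ℛ.R β) :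
    x * φ β r = φ β r * x := by
  obtain ⟨f, rfl⟩ := (D.pres β).surj r
  induction f using FreeAlgebra.induction with
  | grade0 c =>
    have := h 0
    rw [mat_coords_zero] at this
    rw [AlgHom.commutes, Algebra.algebraMap_eq_smul_one, map_smul, mul_smul_comm, this,
      smul_mul_assoc]
  | grade1 i => exact h i.succ
  | mul a b ha hb => rw [map_mul, map_mul, ← mul_assoc, ha, mul_assoc, hb, mul_assoc]
  | add a b ha hb => rw [map_add, map_add, mul_add, ha, hb, add_mul]

theorem hom_eq_of_freeGen {α : A} {Q : Type*} [Ring Q] [Algebra ℂ Q] {k k' : ℛ.R α →ₐ[ℂ] Q}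
    (h : ∀ i, k ((D.pres α).π (freeGen _ i)) = k' ((D.pres α).π (freeGen _ i))) (r : ℛ.R α) :
    k r = k' r := by
  obtain ⟨f, rfl⟩ := (D.pres α).surj r
  have : k.comp (D.pres α).π = k'.comp (D.pres α).π := by
    ext i
    exact h i.succ
  exact DFunLike.congr_fun this f

/-- A point of the locus represents a morphism, through the gluing system that the units `φ_α(1)`
cut out in the block algebra. The compatibility with the gluing isomorphisms follows from the values
on generators alone. -/
theorem representsMorphism_of_isInLocus [Fintype A] [LinearOrder A]
    {φ : ∀ α, RingSetHom (ℛ.R α) n} (h : D.IsInLocus n (D.coords n φ)) :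
    RepresentsMorphism ℛ n φ := by
  have hcomm (α β) (r : ℛ.R β) : φ α 1 * φ β r = φ β r * φ α 1 := by
    have := D.commute_of_mat (h.comm α β) r
    rwa [mat_coords_zero] at this
  have hunit (α) (r : ℛ.R α) : φ α 1 * φ α r = φ α r := by rw [← map_mul, one_mul]
  have hidem (α β) : φ α 1 * φ β 1 ∈ Set.range (φ α) := by
    have := h.idem_mem α β
    rwa [im_coords, mat_coords_zero, mat_coords_zero] at this
  have hown (α β) (r : ℛ.R α) : φ β 1 * φ α r ∈ Set.range (φ α) := by
    obtain ⟨w, hw⟩ := hidem α β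
    exact ⟨w * r, by rw [map_mul, hw, hcomm, mul_assoc, hunit]⟩
  have hmem (β) (r : ℛ.R β) : φ β r ∈ blockAlgebra φ := by
    refine mem_blockAlgebra.2 fun α => ⟨hcomm α β r, ?_⟩
    have h1 : φ α 1 * φ β r ∈ (fun m => φ α 1 * m) '' Set.range (φ β) := ⟨_, ⟨r, rfl⟩, rfl⟩
    have h2 := h.overlap α β
    rw [im_coords, im_coords, mat_coords_zero, mat_coords_zero] at h2
    rw [h2] at h1
    obtain ⟨_, ⟨r', rfl⟩, h3⟩ := h1
    rw [← h3]
    exact hown α β r'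
  let T := blockAlgebra φ
  let ψ (α) (r : ℛ.R α) : T := ⟨φ α r, hmem α r⟩
  let e (α) : Submonoid.center T := ⟨ψ α 1, Submonoid.mem_center_iff.2 fun x =>
    Subtype.ext (mem_blockAlgebra.1 x.2 α).1.symm⟩
  have he (α) : IsIdempotentElem (e α) := Subtype.ext (Subtype.ext (hunit α 1))
  -- The identity in `M_n(ℂ)` restricts to `T`, which contains all the units.
  have hcov (J : Ideal T) (hJ : ∀ α, (e α : T) ∈ J) : J = ⊤ := by
    refine eq_top_of_eq_sum ?_ J hJ
    refine Subtype.ext ?_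
    change (1 : Mat n) = T.val _
    rw [h.incl_excl, map_sum]
    refine Finset.sum_congr rfl fun K _ => ?_
    rw [map_smul, map_list_prod, List.map_map]
    simp only [mat_coords_zero]
    rfl
  let q (α) : ℛ.R α →ₐ[ℂ] Cutoff (e α) :=
    { toFun := fun r => cutoff (e α) (ψ α r)
      map_one' := cutoff_self (he α)
      map_mul' := fun r r' => by
        rw [← map_mul]; exact congrArg _ (Subtype.ext (map_mul (φ α) r r'))
      map_zero' := by
        rw [← map_zero (cutoff (e α))]; exact congrArg _ (Subtype.ext (map_zero (φ α)))
      map_add' := fun r r' => by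
        rw [← map_add]; exact congrArg _ (Subtype.ext (map_add (φ α) r r'))
      commutes' := fun c => by
        rw [Algebra.algebraMap_eq_smul_one, Algebra.algebraMap_eq_smul_one,
          ← cutoff_self (he α), ← map_smul]
        exact congrArg _ (Subtype.ext (map_smul (φ α) c 1)) }
  have hadm (α β) (s : ℛ.R α) (hs : s ∈ ℛ.S α β) :
      q α s ∈ (unitsOn (e β)).map (cutoff (e α)) := by
    have hsc := (ℛ.isLoc α β).central s hs
    obtain ⟨r, hr⟩ := ((φ α).injective_iff_exists_inverse (f := φ β 1) (hunit β 1) (hcomm β α)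
      (hown α β 1) hsc).1 fun r hr => by
        have := h.push_out α β ⟨s, hs⟩ (φ α r) (by rw [im_coords]; exact ⟨r, rfl⟩)
        rw [evalAt_coords, π_lift, mat_coords_zero] at this
        exact this hr
    -- `s` is extended by the identity of the complement of the block of `α`; the inverse over
    -- `β` is assembled likewise.
    have hs1 : φ α s * φ α 1 = φ α s := by rw [← map_mul, mul_one]
    let t : T := ψ α s + (1 - ψ α 1)
    let u : T := ψ β 1 * ψ α r + (1 - ψ α 1)
    have htu : t * u = ψ β 1 * ψ α 1 + (1 - ψ α 1) := by
      refine Subtype.ext ?_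
      change (φ α s + (1 - φ α 1)) * (φ β 1 * φ α r + (1 - φ α 1)) =
        φ β 1 * φ α 1 + (1 - φ α 1)
      have h1 : φ α 1 * (φ β 1 * φ α r) = φ β 1 * φ α r := by
        rw [← mul_assoc, hcomm α β, mul_assoc, hunit]
      simp only [add_mul, mul_add, sub_mul, mul_sub, mul_one, one_mul, hs1, hunit, h1, hr]
      abel
    have hsT (x : T) : x * ψ α s = ψ α s * x := by
      refine Subtype.ext ?_
      change (x : Mat n) * φ α s = φ α s * x
      obtain ⟨hx, r', hr'⟩ := mem_blockAlgebra.1 x.2 α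
      calc (x : Mat n) * φ α s = φ α 1 * x * φ α s := by rw [hx, mul_assoc, hunit]
        _ = φ α s * (φ α 1 * x) := by
          rw [← hr', ← map_mul, ← map_mul, (Set.mem_center_iff.1 hsc).comm]
        _ = φ α s * x := by rw [← mul_assoc, hs1]
    have ht (x : T) : x * t = t * x := by
      have h1 : x * ψ α 1 = ψ α 1 * x := Submonoid.mem_center_iff.1 (e α).2 x
      simp only [t, mul_add, add_mul, mul_sub, sub_mul, hsT, h1, mul_one, one_mul]
    have hinv : cutoff (e β) (t * u) = 1 := by
      rw [htu, ← map_one (cutoff (e β)), cutoff_eq_iff, mul_one]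
      refine Subtype.ext ?_
      change φ β 1 * (φ β 1 * φ α 1 + (1 - φ α 1)) = φ β 1
      rw [mul_add, ← mul_assoc, hunit, mul_sub, mul_one]
      abel
    refine ⟨t, mem_unitsOn.2 ⟨Submonoid.mem_center_iff.2 ht, ?_⟩, ?_⟩
    · refine ⟨⟨cutoff (e β) t, cutoff (e β) u, ?_, ?_⟩, rfl⟩
      · rw [← map_mul, hinv]
      · rw [← map_mul, ht, hinv]
    · refine cutoff_eq_iff.2 (Subtype.ext ?_)
      change φ α 1 * (φ α s + (1 - φ α 1)) = φ α 1 * φ α s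
      rw [mul_add, mul_sub, mul_one, hunit α 1, sub_self, add_zero]
  let 𝒮 := idempotentGluing e he hcov
  have hlift (α β) : ∃ k : ℛ.R₂ α β →ₐ[ℂ] 𝒮.R₂ α β, ∀ r, k (ℛ.loc α β r) = 𝒮.loc α β (q α r) :=
    (ℛ.isLoc α β).exists_lift ((𝒮.loc α β).comp (q α)) fun s hs =>
      (𝒮.isLoc α β).isUnit _ (hadm α β s hs)
  choose k hk using hlift
  have hglue (α β) (y : ℛ.R₂ α β) : k β α (ℛ.glue α β y) = 𝒮.glue α β (k α β y) := by
    refine (ℛ.isLoc α β).hom_ext (k := (k β α).comp (ℛ.glue α β : ℛ.R₂ α β →ₐ[ℂ] ℛ.R₂ β α))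
      (k' := (𝒮.glue α β : 𝒮.R₂ α β →ₐ[ℂ] 𝒮.R₂ β α).comp (k α β)) (fun r => ?_) y
    refine D.hom_eq_of_freeGen (k := ((k β α).comp (ℛ.glue α β : ℛ.R₂ α β →ₐ[ℂ] ℛ.R₂ β α)).comp
      (ℛ.loc α β)) (k' := ((𝒮.glue α β : 𝒮.R₂ α β →ₐ[ℂ] 𝒮.R₂ β α).comp (k α β)).comp
      (ℛ.loc α β)) (fun i => ?_) r
    have hs := (𝒮.isLoc β α).isUnit _ (hadm β α _ (D.ts α β i).2)
    refine hs.mul_right_cancel ?_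
    change k β α (ℛ.glue α β (ℛ.loc α β _)) * 𝒮.loc β α (q β _) =
      𝒮.glue α β (k α β (ℛ.loc α β _)) * _
    rw [← hk, ← map_mul, D.t_spec, hk, hk, hk]
    have h6 := h.glue_gen α β i
    rw [mat_coords_zero, mat_coords_zero, mat_coords, evalAt_coords, evalAt_coords,
      π_lift] at h6
    change cutoff (e β * e α) (ψ β _) = cutoff (e β * e α) (ψ α _ * ψ β _)
    refine cutoff_eq_iff.2 (Subtype.ext ?_)
    change φ β 1 * φ α 1 * φ β _ = φ β 1 * φ α 1 * (φ α _ * φ β _)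
    rw [mul_assoc (φ β 1), mul_assoc (φ β 1), ← mul_assoc (φ α 1) (φ α _), hunit α,
      ← mul_assoc, hcomm β α, mul_assoc, hunit, ← h6, mul_assoc, ← mul_assoc _ (φ α 1), ← map_mul,
      mul_one]
  refine ⟨T, 𝒮, ⟨fun α => unitsOn (e α), fun α => cutoff (e α),
    fun α => isCentralLocalization_cutoff (he α), isCentralCover_unitsOn hcov, fun _ _ => rfl,
    fun _ _ _ => rfl⟩, ⟨q, hadm, k, hk, hglue⟩, fun α => cutoffSection (he α), ?_, ?_, ?_, ?_⟩
  · intro α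
    refine (cutoff_surjective _).forall.2 fun x => ?_
    change cutoff (e α) (cutoffSection (he α) (cutoff (e α) x)) = cutoff (e α) x
    rw [cutoffSection_cutoff, map_mul, cutoff_self (he α), one_mul]
  · intro α x
    change cutoffSection (he α) (cutoff (e α) x) = cutoffSection (he α) 1 * x
    rw [cutoffSection_cutoff, ← cutoff_self (he α), cutoffSection_cutoff]
    exact congrArg (· * x) (congrArg Subtype.val (he α)).symm
  · intro α
    refine (cutoff_surjective _).forall.2 fun x => ?_
    obtain ⟨-, r, hr⟩ := mem_blockAlgebra.1 x.2 α
    refine ⟨r, cutoff_eq_iff.2 (Subtype.ext ?_)⟩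
    change φ α 1 * φ α r = φ α 1 * x
    rw [hunit, hr]
  · intro α r
    change _ = ((cutoffSection (he α) (cutoff (e α) (ψ α r)) : T) : Mat n)
    rw [cutoffSection_cutoff]
    exact (hunit α r).symm

end PresentationData

/-! ### Constructible sets -/

section Constructible

variable {σ : Type v}

/-- A function on the affine space given by a polynomial. -/
def IsPolynomialFun (f : (σ → ℂ) → ℂ) : Prop :=
  ∃ p : MvPolynomial σ ℂ, ∀ x, f x = MvPolynomial.eval x p

namespace IsPolynomialFun

variable {f g : (σ → ℂ) → ℂ}

theorem const (c : ℂ) : IsPolynomialFun fun _ : σ → ℂ => c := ⟨MvPolynomial.C c, by simp⟩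

theorem coord (i : σ) : IsPolynomialFun fun x : σ → ℂ => x i := ⟨MvPolynomial.X i, by simp⟩

theorem add (hf : IsPolynomialFun f) (hg : IsPolynomialFun g) :
    IsPolynomialFun fun x => f x + g x := by
  obtain ⟨p, hp⟩ := hf
  obtain ⟨q, hq⟩ := hg
  exact ⟨p + q, fun x => by simp [hp, hq]⟩

theorem mul (hf : IsPolynomialFun f) (hg : IsPolynomialFun g) :
    IsPolynomialFun fun x => f x * g x := by
  obtain ⟨p, hp⟩ := hf
  obtain ⟨q, hq⟩ := hg
  exact ⟨p * q, fun x => by simp [hp, hq]⟩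

theorem sub (hf : IsPolynomialFun f) (hg : IsPolynomialFun g) :
    IsPolynomialFun fun x => f x - g x := by
  simpa [sub_eq_add_neg] using hf.add ((const (-1)).mul hg)

theorem sum {ι : Type*} {s : Finset ι} {f : ι → (σ → ℂ) → ℂ} (h : ∀ i, IsPolynomialFun (f i)) :
    IsPolynomialFun fun x => ∑ i ∈ s, f i x := by
  choose p hp using h
  exact ⟨∑ i ∈ s, p i, fun x => by simp [hp]⟩

end IsPolynomialFun

/-- A matrix-valued function on the affine space whose entries are polynomials. -/
def IsPolynomialMat {n : ℕ} (M : (σ → ℂ) → Mat n) : Prop :=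
  ∀ j k, IsPolynomialFun fun x => M x j k

namespace IsPolynomialMat

variable {n : ℕ} {M N : (σ → ℂ) → Mat n}

theorem const (m : Mat n) : IsPolynomialMat fun _ : σ → ℂ => m :=
  fun j k => IsPolynomialFun.const (m j k)

theorem add (hM : IsPolynomialMat M) (hN : IsPolynomialMat N) :
    IsPolynomialMat fun x => M x + N x := fun j k => (hM j k).add (hN j k)

theorem sub (hM : IsPolynomialMat M) (hN : IsPolynomialMat N) :
    IsPolynomialMat fun x => M x - N x := fun j k => (hM j k).sub (hN j k)

theorem mul (hM : IsPolynomialMat M) (hN : IsPolynomialMat N) :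
    IsPolynomialMat fun x => M x * N x := by
  intro j k
  simpa only [Matrix.mul_apply] using IsPolynomialFun.sum fun i => (hM j i).mul (hN i k)

theorem smul {f : (σ → ℂ) → ℂ} (hf : IsPolynomialFun f) (hM : IsPolynomialMat M) :
    IsPolynomialMat fun x => f x • M x := fun j k => hf.mul (hM j k)

theorem sum {ι : Type*} {s : Finset ι} {M : ι → (σ → ℂ) → Mat n}
    (h : ∀ i, IsPolynomialMat (M i)) : IsPolynomialMat fun x => ∑ i ∈ s, M i x := by
  intro j k
  simpa only [Matrix.sum_apply] using IsPolynomialFun.sum fun i => h i j k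

theorem list_prod {ι : Type*} {M : ι → (σ → ℂ) → Mat n} (h : ∀ i, IsPolynomialMat (M i))
    (l : List ι) : IsPolynomialMat fun x => (l.map fun i => M i x).prod := by
  induction l with
  | nil => simpa using const (1 : Mat n)
  | cons a l ih => simpa using (h a).mul ih

theorem evalAt {l : ℕ} {M : (σ → ℂ) → Fin (l + 1) → Mat n}
    (h : ∀ i, IsPolynomialMat fun x => M x i) (f : FreeAlgebra ℂ (Fin l)) :
    IsPolynomialMat fun x => evalAt (M x) f := by
  refine (h 0).mul ?_
  induction f using FreeAlgebra.induction with
  | grade0 c => simpa using const _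
  | grade1 i => simpa using h i.succ
  | mul a b ha hb => simpa using ha.mul hb
  | add a b ha hb => simpa using ha.add hb

end IsPolynomialMat

namespace IsZariskiConstructible

theorem univ : IsZariskiConstructible (Set.univ : Set (σ → ℂ)) :=
  ⟨{(∅, 1)}, Set.finite_singleton _, by ext; simp⟩

theorem union {Z Z' : Set (σ → ℂ)} (h : IsZariskiConstructible Z)
    (h' : IsZariskiConstructible Z') : IsZariskiConstructible (Z ∪ Z') := by
  obtain ⟨F, hF, rfl⟩ := h
  obtain ⟨F', hF', rfl⟩ := h'
  refine ⟨F ∪ F', hF.union hF', ?_⟩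
  ext x
  simp only [Set.mem_union, Set.mem_ofPred_eq, or_and_right, exists_or]

theorem inter {Z Z' : Set (σ → ℂ)} (h : IsZariskiConstructible Z)
    (h' : IsZariskiConstructible Z') : IsZariskiConstructible (Z ∩ Z') := by
  classical
  obtain ⟨F, hF, rfl⟩ := h
  obtain ⟨F', hF', rfl⟩ := h'
  refine ⟨Set.image2 (fun c c' => (c.1 ∪ c'.1, c.2 * c'.2)) F F', hF.image2 _ hF', ?_⟩
  ext x
  simp only [Set.mem_inter_iff, Set.mem_ofPred_eq, Set.exists_mem_image2, Finset.mem_union, map_mul,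
    mul_ne_zero_iff]
  constructor
  · rintro ⟨⟨c, hc, h1, h2⟩, c', hc', h1', h2'⟩
    exact ⟨c, hc, c', hc', fun p hp => hp.elim (h1 p) (h1' p), h2, h2'⟩
  · rintro ⟨c, hc, c', hc', h1, h2, h2'⟩
    exact ⟨⟨c, hc, fun p hp => h1 p (.inl hp), h2⟩, c', hc', fun p hp => h1 p (.inr hp), h2'⟩

theorem iUnion {ι : Type*} [Finite ι] {Z : ι → Set (σ → ℂ)}
    (h : ∀ i, IsZariskiConstructible (Z i)) : IsZariskiConstructible (⋃ i, Z i) := by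
  choose F hF hZ using h
  refine ⟨⋃ i, F i, Set.finite_iUnion hF, ?_⟩
  ext x
  simp only [hZ, Set.mem_iUnion, Set.mem_ofPred_eq]
  constructor
  · rintro ⟨i, c, hc, h⟩; exact ⟨c, ⟨i, hc⟩, h⟩
  · rintro ⟨c, ⟨i, hc⟩, h⟩; exact ⟨i, c, hc, h⟩

theorem setOf_forall_mem {ι : Type*} {s : Set ι} (hs : s.Finite) {P : ι → (σ → ℂ) → Prop}
    (h : ∀ i, IsZariskiConstructible {x | P i x}) :
    IsZariskiConstructible {x | ∀ i ∈ s, P i x} := by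
  induction s, hs using Set.Finite.induction_on with
  | empty => simpa using univ
  | insert _ _ ih => simpa [Set.ofPred_and] using (h _).inter ih

theorem setOf_forall {ι : Type*} [Finite ι] {P : ι → (σ → ℂ) → Prop}
    (h : ∀ i, IsZariskiConstructible {x | P i x}) : IsZariskiConstructible {x | ∀ i, P i x} := by
  simpa using setOf_forall_mem Set.finite_univ h

theorem setOf_ne_zero {f : (σ → ℂ) → ℂ} (hf : IsPolynomialFun f) :
    IsZariskiConstructible {x | f x ≠ 0} := by
  obtain ⟨p, hp⟩ := hf
  exact ⟨{(∅, p)}, Set.finite_singleton _, by ext; simp [hp]⟩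

/-- By Hilbert's basis theorem, the common zeros of arbitrarily many polynomials form a
constructible set. -/
theorem setOf_forall_eq_zero [Finite σ] {ι : Type*} {f : ι → (σ → ℂ) → ℂ}
    (hf : ∀ i, IsPolynomialFun (f i)) : IsZariskiConstructible {x | ∀ i, f i x = 0} := by
  choose p hp using hf
  obtain ⟨P, hP⟩ := IsNoetherian.noetherian (Ideal.span (Set.range p))
  refine ⟨{(P, 1)}, Set.finite_singleton _, ?_⟩
  have key (s : Set (MvPolynomial σ ℂ)) (x : σ → ℂ) :
      (∀ q ∈ s, MvPolynomial.eval x q = 0) ↔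
        Ideal.span s ≤ RingHom.ker (MvPolynomial.eval x) := by
    rw [Ideal.span_le]; rfl
  ext x
  have h1 := key (Set.range p) x
  rw [← hP] at h1
  have h2 := h1.trans (key P x).symm
  simpa [hp] using h2

theorem setOf_forall_mat_eq [Finite σ] {n : ℕ} {ι : Type*} {M N : ι → (σ → ℂ) → Mat n}
    (hM : ∀ i, IsPolynomialMat (M i)) (hN : ∀ i, IsPolynomialMat (N i)) :
    IsZariskiConstructible {x | ∀ i, M i x = N i x} := by
  have := setOf_forall_eq_zero (σ := σ) (ι := ι × Fin n × Fin n)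
    (f := fun c x => M c.1 x c.2.1 c.2.2 - N c.1 x c.2.1 c.2.2)
    fun c => (hM c.1 c.2.1 c.2.2).sub (hN c.1 c.2.1 c.2.2)
  simpa [sub_eq_zero, ← Matrix.ext_iff] using this

theorem setOf_mat_eq [Finite σ] {n : ℕ} {M N : (σ → ℂ) → Mat n}
    (hM : IsPolynomialMat M) (hN : IsPolynomialMat N) :
    IsZariskiConstructible {x | M x = N x} := by
  simpa using setOf_forall_mat_eq (ι := Unit) (fun _ => hM) fun _ => hN

/-- Gaussian elimination: where some entry of the first matrix `v` does not vanish, it can be used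
to clear the same entry of all others; where all of them vanish, `v` can be dropped. -/
theorem setOf_mem_span [Finite σ] {n : ℕ} (l : List ((σ → ℂ) → Mat n))
    (hl : ∀ v ∈ l, IsPolynomialMat v) {w : (σ → ℂ) → Mat n} (hw : IsPolynomialMat w) :
    IsZariskiConstructible {x | w x ∈ Submodule.span ℂ {u | ∃ v ∈ l, v x = u}} := by
  induction hm : l.length generalizing l w with
  | zero =>
    rw [List.length_eq_zero_iff.1 hm]
    simpa using setOf_mat_eq hw (.const 0)
  | succ m ih =>
    obtain _ | ⟨v, l⟩ := l
    · simp at hm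
    have hv := hl v List.mem_cons_self
    have hl' : ∀ v ∈ l, IsPolynomialMat v := fun u hu => hl u (List.mem_cons_of_mem _ hu)
    have hlen : l.length = m := by simpa using hm
    -- `E j k` annihilates `v`, and modulo `v` it is multiplication by `v x j k`.
    let E (j k : Fin n) (u : (σ → ℂ) → Mat n) (x : σ → ℂ) : Mat n :=
      v x j k • u x - u x j k • v x
    have hE (j k) {u} (hu : IsPolynomialMat u) : IsPolynomialMat (E j k u) :=
      (hu.smul (hv j k)).sub (hv.smul (hu j k))
    have hset : {x | w x ∈ Submodule.span ℂ {u | ∃ v' ∈ v :: l, v' x = u}} =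
        ({x | v x = 0} ∩ {x | w x ∈ Submodule.span ℂ {u | ∃ v ∈ l, v x = u}}) ∪
        ⋃ j, ⋃ k, {x | v x j k ≠ 0} ∩
          {x | E j k w x ∈ Submodule.span ℂ {u | ∃ v' ∈ l.map (E j k), v' x = u}} := by
      ext x
      have hins : {u | ∃ v' ∈ v :: l, v' x = u} = insert (v x) {u | ∃ v ∈ l, v x = u} := by
        ext u; simp [eq_comm]
      simp only [Set.mem_union, Set.mem_inter_iff, Set.mem_iUnion, Set.mem_ofPred_eq, hins]
      have key (j k) (hjk : v x j k ≠ 0) :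
          w x ∈ Submodule.span ℂ (insert (v x) {u | ∃ v ∈ l, v x = u}) ↔
          E j k w x ∈ Submodule.span ℂ {u | ∃ v' ∈ l.map (E j k), v' x = u} := by
        let L : Mat n →ₗ[ℂ] Mat n :=
          { toFun := fun u => v x j k • u - u j k • v x
            map_add' := fun u u' => by
              rw [Matrix.add_apply, add_smul, smul_add]; abel
            map_smul' := fun c u => by
              rw [Matrix.smul_apply, smul_eq_mul, mul_smul, smul_comm, RingHom.id_apply, smul_sub] }
        have hset' : {u | ∃ v' ∈ l.map (E j k), v' x = u} = L '' {u | ∃ v ∈ l, v x = u} := by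
          ext u
          constructor
          · rintro ⟨v', hv', rfl⟩
            obtain ⟨u, hu, rfl⟩ := List.mem_map.1 hv'
            exact ⟨_, ⟨u, hu, rfl⟩, rfl⟩
          · rintro ⟨_, ⟨u, hu, rfl⟩, rfl⟩
            exact ⟨_, List.mem_map.2 ⟨u, hu, rfl⟩, rfl⟩
        rw [hset', Submodule.span_image]
        change _ ↔ L (w x) ∈ _
        constructor
        · intro h
          obtain ⟨a, z, hz, hwz⟩ := Submodule.mem_span_insert.1 h
          refine ⟨z, hz, ?_⟩
          have : L (v x) = 0 := sub_self _
          rw [hwz, map_add, map_smul, this, smul_zero, zero_add]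
        · rintro ⟨z, hz, hzw⟩
          have hzw' : v x j k • z - z j k • v x = v x j k • w x - w x j k • v x := hzw
          refine Submodule.mem_span_insert.2 ⟨(v x j k)⁻¹ * (w x j k - z j k), z, hz, ?_⟩
          have h1 : v x j k • w x = (w x j k - z j k) • v x + v x j k • z := by
            rw [sub_smul, ← sub_eq_zero]
            rw [← sub_eq_zero] at hzw'
            rw [← neg_eq_zero, ← hzw']; abel
          have h2 : (v x j k)⁻¹ • (v x j k • z) = z := inv_smul_smul₀ hjk z
          have h3 : (v x j k)⁻¹ • (v x j k • w x) = w x := inv_smul_smul₀ hjk (w x)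
          rw [h1, smul_add, h2, smul_smul] at h3
          exact h3.symm
      constructor
      · intro h
        by_cases h0 : v x = 0
        · rw [h0, Submodule.span_insert_zero] at h
          exact .inl ⟨h0, h⟩
        · obtain ⟨j, k, hjk⟩ : ∃ j k, v x j k ≠ 0 := by
            by_contra! hc
            exact h0 (Matrix.ext hc)
          exact .inr ⟨j, k, hjk, (key j k hjk).1 h⟩
      · rintro (⟨-, h⟩ | ⟨j, k, hjk, h⟩)
        · exact Submodule.span_mono (Set.subset_insert _ _) h
        · exact (key j k hjk).2 h
    rw [hset]
    refine ((setOf_mat_eq hv (.const 0)).inter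
      (ih l hl' hw hlen)).union (iUnion fun j => iUnion fun k => (setOf_ne_zero (hv j k)).inter
        (ih _ ?_ (hE j k hw) (by simpa using hlen)))
    intro u hu
    obtain ⟨u', hu', rfl⟩ := List.mem_map.1 hu
    exact hE j k (hl' u' hu')

end IsZariskiConstructible

end Constructible

/-! ### Bounding the length of words -/

/-- A subspace that contains `1` generates a finite-dimensional algebra in at most as many steps
as the dimension. -/
theorem Submodule.pow_le_pow_finrank {B : Type*} [Ring B] [Algebra ℂ B] [FiniteDimensional ℂ B]
    {V : Submodule ℂ B} (hV : 1 ≤ V) (k : ℕ) : V ^ k ≤ V ^ Module.finrank ℂ B := by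
  have step (k : ℕ) : V ^ k ≤ V ^ (k + 1) := by
    rw [pow_succ]; exact le_mul_of_one_le_right' hV
  -- Each strict inclusion raises the dimension; once two powers agree, all later ones do.
  have h (k : ℕ) : V ^ (k + 1) = V ^ k ∨ k + 1 ≤ Module.finrank ℂ ↥(V ^ (k + 1)) := by
    induction k with
    | zero =>
      by_cases h : V ^ (0 + 1) = V ^ 0
      · exact .inl h
      · have := Submodule.finrank_lt_finrank_of_lt (lt_of_le_of_ne (step 0) (Ne.symm h))
        exact .inr (by omega)
    | succ k ih =>
      by_cases h : V ^ (k + 1 + 1) = V ^ (k + 1)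
      · exact .inl h
      · rcases ih with ih | ih
        · exact .inl (by rw [pow_succ, ih, ← pow_succ, ih])
        · have := Submodule.finrank_lt_finrank_of_lt (lt_of_le_of_ne (step (k + 1)) (Ne.symm h))
          exact .inr (by omega)
  have hd : V ^ (Module.finrank ℂ B + 1) = V ^ Module.finrank ℂ B := by
    refine (h _).resolve_right fun h => ?_
    have := Submodule.finrank_le (V ^ (Module.finrank ℂ B + 1))
    omega
  have hk (j : ℕ) : V ^ (Module.finrank ℂ B + j) = V ^ Module.finrank ℂ B := by
    induction j with
    | zero => rfl
    | succ j ih => rw [← add_assoc, pow_succ, ih, ← pow_succ, hd]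
  rw [← hk k]
  exact monotone_nat_of_le_succ step (Nat.le_add_left _ _)

open scoped Pointwise in
/-- The values of all noncommutative polynomials at matrices are spanned by the values of the words
of bounded length, the bound depending only on the size of the matrices. -/
theorem exists_words (l n : ℕ) : ∃ W : List (FreeAlgebra ℂ (Fin l)),
    ∀ (M : Fin (l + 1) → Mat n) (L : Mat n →ₗ[ℂ] Mat n) (y : Mat n),
      y ∈ Submodule.span ℂ {u | ∃ f ∈ W, L (evalAt M f) = u} ↔ ∃ f, L (evalAt M f) = y := by
  let s : Set (FreeAlgebra ℂ (Fin l)) := insert 1 (Set.range (FreeAlgebra.ι ℂ))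
  let U := Submodule.span ℂ s
  have hU : 1 ≤ U := by
    rw [Submodule.one_eq_span, Submodule.span_singleton_le_iff_mem]
    exact Submodule.subset_span (Set.mem_insert _ _)
  have hmono : Monotone fun k => U ^ k := monotone_nat_of_le_succ fun k => by
    rw [pow_succ]; exact le_mul_of_one_le_right' hU
  have hall (f) : ∃ k, f ∈ U ^ k := by
    induction f using FreeAlgebra.induction with
    | grade0 c => exact ⟨0, by rw [pow_zero]; exact Submodule.algebraMap_mem c⟩
    | grade1 i =>
      exact ⟨1, by rw [pow_one]; exact Submodule.subset_span (Set.mem_insert_of_mem _ ⟨i, rfl⟩)⟩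
    | mul a b ha hb =>
      obtain ⟨k, hk⟩ := ha
      obtain ⟨k', hk'⟩ := hb
      exact ⟨k + k', by rw [pow_add]; exact Submodule.mul_mem_mul hk hk'⟩
    | add a b ha hb =>
      obtain ⟨k, hk⟩ := ha
      obtain ⟨k', hk'⟩ := hb
      exact ⟨max k k', add_mem (hmono (le_max_left _ _) hk) (hmono (le_max_right _ _) hk')⟩
  let d := Module.finrank ℂ (Mat n)
  have hfin : (s ^ d).Finite := by
    generalize d = d
    induction d with
    | zero => rw [pow_zero]; exact Set.finite_one
    | succ d ih => rw [pow_succ]; exact ih.mul ((Set.finite_range _).insert _)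
  refine ⟨hfin.toFinset.toList, fun M L y => ?_⟩
  let Ev : FreeAlgebra ℂ (Fin l) →ₗ[ℂ] Mat n := L ∘ₗ LinearMap.mulLeft ℂ (M 0) ∘ₗ
    (FreeAlgebra.lift ℂ fun i : Fin l => M i.succ).toLinearMap
  have hset : {u | ∃ f ∈ hfin.toFinset.toList, L (evalAt M f) = u} = Ev '' (s ^ d) := by
    ext u; simp [Ev, evalAt]
  rw [hset, Submodule.span_image, ← Submodule.span_pow]
  constructor
  · rintro ⟨f, -, h⟩; exact ⟨f, h⟩
  · rintro ⟨f, rfl⟩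
    obtain ⟨k, hk⟩ := hall f
    let ev := FreeAlgebra.lift ℂ fun i : Fin l => M i.succ
    have h1 : ev f ∈ (U.map ev.toLinearMap) ^ d := by
      refine Submodule.pow_le_pow_finrank ?_ k ?_
      · rw [Submodule.one_eq_span, Submodule.span_singleton_le_iff_mem]
        exact ⟨1, Submodule.one_le.1 hU, map_one ev⟩
      · rw [← Submodule.map_pow]; exact ⟨f, hk, rfl⟩
    rw [← Submodule.map_pow] at h1
    obtain ⟨g, hg, hgf⟩ := h1
    refine ⟨g, hg, ?_⟩
    change L (M 0 * ev g) = L (M 0 * ev f)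
    exact congrArg (fun z => L (M 0 * z)) hgf

/-! ### The locus is constructible -/

namespace PresentationData

variable {A : Type v} {ℛ : GluingSystem.{u, v} A} (D : PresentationData ℛ) {n : ℕ}

theorem isPolynomialMat_mat (α : A) (i) :
    IsPolynomialMat fun x : D.Coord n → ℂ => D.mat x α i :=
  fun _ _ => IsPolynomialFun.coord _

theorem isPolynomialMat_evalAt (α : A) (f) :
    IsPolynomialMat fun x : D.Coord n → ℂ => evalAt (D.mat x α) f :=
  IsPolynomialMat.evalAt (D.isPolynomialMat_mat α) f

theorem isZariskiConstructible_rep [Finite A] : IsZariskiConstructible (D.rep n) := by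
  have hM (α i) := D.isPolynomialMat_mat (n := n) α i
  refine .setOf_forall fun α => .inter (.setOf_forall fun i => .inter ?_ ?_) ?_
  · exact .setOf_mat_eq ((hM α 0).mul (hM α i)) (hM α i)
  · exact .setOf_mat_eq ((hM α i).mul (hM α 0)) (hM α i)
  · exact .setOf_forall_mat_eq (fun j => D.isPolynomialMat_evalAt α ((D.pres α).rel j))
      fun _ => .const 0

/-- The push-out condition for `s` means that `s` has an inverse in the part of the image of the
chart `α` that lies over `β`. In this form the condition is a span membership, and it passes to
products in `s`. -/
theorem push_out_iff_exists {φ : ∀ α, RingSetHom (ℛ.R α) n} {α β : A}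
    (hc : ∀ i, D.mat (D.coords n φ) β 0 * D.mat (D.coords n φ) α i =
      D.mat (D.coords n φ) α i * D.mat (D.coords n φ) β 0)
    (hm : D.mat (D.coords n φ) α 0 * D.mat (D.coords n φ) β 0 ∈ D.im (D.coords n φ) α)
    (s : ℛ.S α β) :
    (∀ m ∈ D.im (D.coords n φ) α, evalAt (D.mat (D.coords n φ) α) (D.lift α β s) * m = 0 →
      D.mat (D.coords n φ) β 0 * m = 0) ↔
    ∃ r, φ α s * (φ β 1 * φ α r) = φ β 1 * φ α 1 := by
  have hc' := D.commute_of_mat hc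
  rw [mat_coords_zero] at hc'
  rw [mat_coords_zero, mat_coords_zero, im_coords, ← hc'] at hm
  rw [im_coords, mat_coords_zero, evalAt_coords, π_lift, Set.forall_mem_range]
  exact (φ α).injective_iff_exists_inverse (by rw [← map_mul, one_mul]) hc' hm
    ((ℛ.isLoc α β).central s s.2)

/-- It is enough to find inverses for generators of the multiplicatively closed set. -/
theorem push_out_of_generators {φ : ∀ α, RingSetHom (ℛ.R α) n} {α β : A}
    (hc : ∀ r, φ β 1 * φ α r = φ α r * φ β 1) {G : Set (ℛ.R α)}
    (hG : ∀ s ∈ G, ∃ r, φ α s * (φ β 1 * φ α r) = φ β 1 * φ α 1) (s : ℛ.R α)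
    (hs : s ∈ Submonoid.closure G) : ∃ r, φ α s * (φ β 1 * φ α r) = φ β 1 * φ α 1 := by
  induction hs using Submonoid.closure_induction with
  | mem s hs => exact hG s hs
  | one => exact ⟨1, by rw [hc, ← mul_assoc, ← map_mul, one_mul]⟩
  | mul s s' _ _ h h' =>
    obtain ⟨r, hr⟩ := h
    obtain ⟨r', hr'⟩ := h'
    refine ⟨r' * r, ?_⟩
    rw [map_mul, map_mul, mul_assoc, ← mul_assoc (φ β 1), ← mul_assoc (φ α s'), hr', mul_assoc,
      ← map_mul, one_mul, hr]

theorem isZariskiConstructible_locus [Fintype A] [LinearOrder A]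
    (hfg : ∀ α β, (ℛ.S α β).FG) : IsZariskiConstructible (D.locus n) := by
  have hM (α i) := D.isPolynomialMat_mat (n := n) α i
  have hE (α f) := D.isPolynomialMat_evalAt (n := n) α f
  choose G hG using hfg
  have hGS {α β g} (hg : g ∈ G α β) : g ∈ ℛ.S α β := hG α β ▸ Submonoid.subset_closure hg
  choose W hW using fun α => exists_words (D.pres α).l n
  -- Membership in the image of `Im_α` under a linear map depending polynomially on the point.
  have hspan (α : A) (L : (D.Coord n → ℂ) → Mat n →ₗ[ℂ] Mat n)
      (hL : ∀ N : (D.Coord n → ℂ) → Mat n, IsPolynomialMat N → IsPolynomialMat fun x => L x (N x))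
      (w : (D.Coord n → ℂ) → Mat n) (hw : IsPolynomialMat w) :
      IsZariskiConstructible {x | ∃ f, L x (evalAt (D.mat x α) f) = w x} := by
    have h := IsZariskiConstructible.setOf_mem_span
      ((W α).map fun f (x : D.Coord n → ℂ) => L x (evalAt (D.mat x α) f))
      (fun v hv => by
        obtain ⟨f, -, rfl⟩ := List.mem_map.1 hv
        exact hL _ (hE α f)) hw
    convert h using 1
    ext x
    simp only [Set.mem_ofPred_eq, ← hW α (D.mat x α) (L x), List.mem_map, exists_exists_and_eq_and]
  have hcomm : IsZariskiConstructible {x : D.Coord n → ℂ |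
      ∀ α β i, D.mat x α 0 * D.mat x β i = D.mat x β i * D.mat x α 0} :=
    .setOf_forall fun α => .setOf_forall fun β => .setOf_forall_mat_eq
      (fun i => (hM α 0).mul (hM β i)) fun i => (hM β i).mul (hM α 0)
  have hgen : IsZariskiConstructible {x : D.Coord n → ℂ | ∀ α β i,
      (D.mat x β 0 * D.mat x α i) *
        (D.mat x α 0 * evalAt (D.mat x β) (D.lift β α (D.ts α β i))) =
      D.mat x α 0 * evalAt (D.mat x β) (D.tg α β i)} :=
    .setOf_forall fun α => .setOf_forall fun β => .setOf_forall_mat_eq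
      (fun i => ((hM β 0).mul (hM α i)).mul ((hM α 0).mul (hE β _)))
      fun i => (hM α 0).mul (hE β _)
  have hloc : IsZariskiConstructible {x : D.Coord n → ℂ | ∀ α β, ∀ s : ℛ.S α β,
      (D.mat x β 0 * D.mat x α 0) *
        (D.mat x α 0 * evalAt (D.mat x β) (D.lift β α (D.tsS α β s))) =
      (D.mat x α 0 * evalAt (D.mat x β) (D.tgS α β s)) *
        (D.mat x β 0 * evalAt (D.mat x α) (D.lift α β s))} :=
    .setOf_forall fun α => .setOf_forall fun β => .setOf_forall_mat_eq
      (fun s => ((hM β 0).mul (hM α 0)).mul ((hM α 0).mul (hE β _)))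
      fun s => ((hM α 0).mul (hE β _)).mul ((hM β 0).mul (hE α _))
  have hincl : IsZariskiConstructible {x : D.Coord n → ℂ | (1 : Mat n) =
      ∑ K ∈ (Finset.univ : Finset A).powerset with K.Nonempty,
        (-1 : ℂ) ^ (K.card + 1) • ((K.sort (· ≤ ·)).map (fun α => D.mat x α 0)).prod} :=
    .setOf_mat_eq (.const 1) (.sum fun K =>
      (IsPolynomialMat.list_prod (fun α => hM α 0) (K.sort (· ≤ ·))).smul (.const _))
  have hover : IsZariskiConstructible {x : D.Coord n → ℂ | ∀ α β, ∀ f ∈ {f | f ∈ W β},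
      ∃ g, D.mat x β 0 * evalAt (D.mat x α) g = D.mat x α 0 * evalAt (D.mat x β) f} :=
    .setOf_forall fun α => .setOf_forall fun β => .setOf_forall_mem (W β).finite_toSet fun f =>
      hspan α (fun x => LinearMap.mulLeft ℂ (D.mat x β 0)) (fun N hN => (hM β 0).mul hN) _
        ((hM α 0).mul (hE β f))
  have hidem : IsZariskiConstructible {x : D.Coord n → ℂ | ∀ α β,
      ∃ g, evalAt (D.mat x α) g = D.mat x α 0 * D.mat x β 0} :=
    .setOf_forall fun α => .setOf_forall fun β =>
      hspan α (fun x => LinearMap.id) (fun _ => id) _ ((hM α 0).mul (hM β 0))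
  have hpush : IsZariskiConstructible {x : D.Coord n → ℂ | ∀ α β, ∀ g : G α β,
      ∃ f, evalAt (D.mat x α) (D.lift α β ⟨g, hGS g.2⟩) *
        (D.mat x β 0 * evalAt (D.mat x α) f) = D.mat x β 0 * D.mat x α 0} :=
    .setOf_forall fun α => .setOf_forall fun β => .setOf_forall fun g =>
      hspan α (fun x => LinearMap.mulLeft ℂ (evalAt (D.mat x α) (D.lift α β ⟨g, hGS g.2⟩)) ∘ₗ
        LinearMap.mulLeft ℂ (D.mat x β 0)) (fun N hN => (hE α _).mul ((hM β 0).mul hN))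
        _ ((hM β 0).mul (hM α 0))
  convert ((((((D.isZariskiConstructible_rep.inter hcomm).inter hgen).inter hloc).inter
    hincl).inter hover).inter hidem).inter hpush using 1
  ext x
  simp only [Set.mem_inter_iff, Set.mem_ofPred_eq]
  -- The words span all values, so the inclusion of images can be tested on them.
  have himg (h : ∀ α β, ∀ f ∈ W β,
      ∃ g, D.mat x β 0 * evalAt (D.mat x α) g = D.mat x α 0 * evalAt (D.mat x β) f) (α β) :
      (fun m => D.mat x α 0 * m) '' D.im x β ⊆ (fun m => D.mat x β 0 * m) '' D.im x α := by
    rintro _ ⟨_, ⟨f, rfl⟩, rfl⟩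
    have h1 := (hW β (D.mat x β) (LinearMap.mulLeft ℂ (D.mat x α 0)) _).2 ⟨f, rfl⟩
    have h2 := (hW α (D.mat x α) (LinearMap.mulLeft ℂ (D.mat x β 0))
      (D.mat x α 0 * evalAt (D.mat x β) f)).1 (Submodule.span_le.2 (by
        rintro _ ⟨f, hf, rfl⟩
        exact (hW α (D.mat x α) (LinearMap.mulLeft ℂ (D.mat x β 0)) _).2 (h α β f hf)) h1)
    obtain ⟨g, hg⟩ := h2
    exact ⟨_, ⟨g, rfl⟩, hg⟩
  constructor
  · intro h
    obtain ⟨φ, rfl⟩ : x ∈ Set.range (D.coords n) := D.range_coords ▸ h.mem_rep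
    refine ⟨⟨⟨⟨⟨⟨⟨h.mem_rep, h.comm⟩, h.glue_gen⟩, h.glue_loc⟩, h.incl_excl⟩, ?_⟩,
      h.idem_mem⟩, ?_⟩
    · intro α β f _
      obtain ⟨_, ⟨g, rfl⟩, hg⟩ := (h.overlap α β).subset ⟨_, ⟨f, rfl⟩, rfl⟩
      exact ⟨g, hg⟩
    · intro α β g
      obtain ⟨r, hr⟩ := (D.push_out_iff_exists (φ := φ) (h.comm β α) (h.idem_mem α β) _).1
        (h.push_out α β ⟨g, hGS g.2⟩)
      obtain ⟨f, rfl⟩ := (D.pres α).surj r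
      refine ⟨f, ?_⟩
      rw [evalAt_coords, evalAt_coords, mat_coords_zero, mat_coords_zero, π_lift]
      exact hr
  · rintro ⟨⟨⟨⟨⟨⟨⟨h1, h2⟩, h3⟩, h4⟩, h5⟩, h6⟩, h7⟩, h8⟩
    obtain ⟨φ, rfl⟩ : x ∈ Set.range (D.coords n) := D.range_coords ▸ h1
    refine ⟨h1, h2, fun α β => ?_, h7, ?_, ?_, h3, h4⟩
    · exact (himg h6 α β).antisymm (himg h6 β α)
    · exact h5
    intro α β s
    refine (D.push_out_iff_exists (φ := φ) (h2 β α) (h7 α β) s).2 ?_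
    have hc := D.commute_of_mat (φ := φ) (h2 β α)
    rw [mat_coords_zero] at hc
    refine push_out_of_generators hc (G := (G α β : Set (ℛ.R α))) (fun g hg => ?_) s
      (by rw [hG]; exact s.2)
    obtain ⟨f, hf⟩ := h8 α β ⟨g, hg⟩
    rw [evalAt_coords, evalAt_coords, mat_coords_zero, mat_coords_zero, π_lift] at hf
    exact ⟨_, hf⟩

/-! ### Change of presentation -/

theorem coords_image_morSpace [Fintype A] [LinearOrder A] :
    D.coords n '' MorSpace ℛ n = D.locus n := by
  ext x; constructor
  · rintro ⟨φ, hφ, rfl⟩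
    exact D.isInLocus_of_representsMorphism hφ
  · intro hx
    obtain ⟨φ, rfl⟩ : x ∈ Set.range (D.coords n) := D.range_coords ▸ hx.mem_rep
    exact ⟨φ, D.representsMorphism_of_isInLocus hx, rfl⟩

theorem exists_polynomialMap (D' : PresentationData ℛ) :
    ∃ F : (D.Coord n → ℂ) → (D'.Coord n → ℂ),
      IsPolynomialMap F ∧ ∀ φ, F (D.coords n φ) = D'.coords n φ := by
  choose σ hσ using fun α => (D.pres α).surj
  choose P hP using fun c : D'.Coord n => D.isPolynomialMat_evalAt (n := n) c.1
    (σ c.1 ((D'.pres c.1).π (freeGen _ c.2.1))) c.2.2.1 c.2.2.2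
  refine ⟨fun x c => evalAt (D.mat x c.1) (σ c.1 ((D'.pres c.1).π (freeGen _ c.2.1)))
    c.2.2.1 c.2.2.2, ⟨P, fun x c => hP c x⟩, fun φ => ?_⟩
  funext c
  change evalAt (D.mat (D.coords n φ) c.1) _ c.2.2.1 c.2.2.2 = _
  rw [evalAt_coords, hσ]
  rfl

theorem bijOn_locus [Fintype A] [LinearOrder A] {D' : PresentationData ℛ}
    {F : (D.Coord n → ℂ) → (D'.Coord n → ℂ)} (hF : ∀ φ, F (D.coords n φ) = D'.coords n φ) :
    Set.BijOn F (D.locus n) (D'.locus n) := by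
  rw [← coords_image_morSpace, ← coords_image_morSpace]
  refine ⟨?_, ?_, ?_⟩
  · rintro _ ⟨φ, hφ, rfl⟩
    exact ⟨φ, hφ, (hF φ).symm⟩
  · rintro _ ⟨φ, -, rfl⟩ _ ⟨ψ, -, rfl⟩ h
    rw [hF, hF] at h
    rw [D'.coords_injective h]
  · rintro _ ⟨φ, hφ, rfl⟩
    exact ⟨_, ⟨φ, hφ, rfl⟩, hF φ⟩

end PresentationData
theorem proposition3p2p11 {A : Type v} [Fintype A] [LinearOrder A] (ℛ : GluingSystem.{u, v} A)
    (hfp : ∀ α, Nonempty (FinPresentation (ℛ.R α)))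
    (hfg : ∀ α β, (ℛ.S α β).FG) (n : ℕ) :
    Nonempty (PresentationData ℛ) ∧
    (∀ D : PresentationData ℛ,
      Function.Injective (D.coords n) ∧
      Set.range (D.coords n) = D.rep n ∧
      D.coords n '' MorSpace ℛ n = D.locus n ∧
      IsZariskiConstructible (D.locus n)) ∧
    (∀ D D' : PresentationData ℛ,
      ∃ (F : (D.Coord n → ℂ) → (D'.Coord n → ℂ)) (G : (D'.Coord n → ℂ) → (D.Coord n → ℂ)),
        IsPolynomialMap F ∧ IsPolynomialMap G ∧
        (∀ φ, F (D.coords n φ) = D'.coords n φ) ∧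
        (∀ φ, G (D'.coords n φ) = D.coords n φ) ∧
        Set.BijOn F (D.locus n) (D'.locus n) ∧
        Set.BijOn G (D'.locus n) (D.locus n)) := by
  refine ⟨PresentationData.nonempty hfp, fun D => ⟨D.coords_injective, D.range_coords,
    D.coords_image_morSpace, D.isZariskiConstructible_locus hfg⟩, fun D D' => ?_⟩
  obtain ⟨F, hF, hF'⟩ := D.exists_polynomialMap (n := n) D'
  obtain ⟨G, hG, hG'⟩ := D'.exists_polynomialMap (n := n) D
  exact ⟨F, G, hF, hG, hF', hG', D.bijOn_locus hF', D'.bijOn_locus hG'⟩
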